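/- **Setting.** For $n\ge 1$ and $0\le d\le n$ let $G^{\mathrm{bip}}_{n,d}$ be the random bipartite graph on parts $L,R$ of size $n$ each in which every pair in $L\times R$ is an edge independently with probability $d/n$; it is encoded by $A\in\{0,1\}^{n^2}$. A polynomial of degree (at most) $D$ is a map $f=(f_v)_{v\in L\cup R}:\mathbb R^{n^2}\to\mathbb R^{2n}$ whose coordinates are real polynomials of degree at most $D$; a random polynomial of degree $D$ is a family $f(\cdot,\omega)$ of such maps whose coefficients are random variables on a probability space $(\Omega,P)$, independent of $A$. For $\eta\ge 0$ put $I=\{v: f_v(A,\omega)\ge 1\}$, $\tilde I=\{v\in I: v\text{ has no neighbour in } I\}$, $J=\{v: \tfrac12<f_v(A,\omega)<1\}$, and let $V^\eta_f(A,\omega)=\tilde I$ if $|I\setminus\tilde I|+|J|\le\eta n$ and $V^\eta_f(A,\omega)=\varnothing$ otherwise. We say that $f$ $(k_\ell,k_r,\delta,\xi,\eta)$-optimizes the independent set problem in $G^{\mathrm{bip}}_{n,d}$ if, for $A\sim G^{\mathrm{bip}}_{n,d}$, $$\mathbb E_{A,\omega}\|f(A,\omega)\|^2\le\xi(k_\ell+k_r)\quad\text{and}\quad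 \mathbb P_{A,\omega}\big[|V^\eta_f\cap L|\ge k_\ell,\ |V^\eta_f\cap R|\ge k_r\big]\ge 1-\delta ,$$ where $\|\cdot\|$ is the Euclidean norm. **Theorem.** Let $\varepsilon>0$. (i) For every real $d>0$ there are $\xi\ge1$ and a sequence $\delta_n\in[0,1]$ with $\delta_n\to0$ such that for all $n\ge d$ and all real $k_\ell,k_r\ge0$ with $k_\ell+k_r\ge1$, $k_\ell\le(1-\varepsilon)\frac{\log d}{d}n$ and $k_r\le(1-\varepsilon)d^{\varepsilon-1}n$, there is a (deterministic) polynomial of degree at most $1$ that $(k_\ell,k_r,\delta_n,\xi,0)$-optimizes the independent set problem in $G^{\mathrm{bip}}_{n,d}$. (ii) There is $d_0>0$ such that for every real $d\ge d_0$ there are $n_0\in\mathbb N$ and $\eta,C_1,C_2>0$ such that for all $n\ge n_0$, all real $k_\ell,k_r$ with $\min\{k_\ell,k_r\}\ge(1+\varepsilon)\frac{\log d}{d}n$, all $\xi\ge1$, all integers $D$ with $1\le D\le\frac{C_1n}{\xi\log n}$ and all $0\le\delta\le\exp(-C_2\,\xi D\log n)$, no random polynomial of degree $D$ $(k_\ell,k_r,\delta,\xi,\eta)$-optimizes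 the independent set problem in $G^{\mathrm{bip}}_{n,d}$. -/

import Mathlib

open MeasureTheory ProbabilityTheory
open scoped ENNReal

noncomputable section

/-- The `2n` vertices: `Sum.inl i` are the vertices of `L`, `Sum.inr j` those of `R`. -/
abbrev BipVertex (n : ℕ) : Type := Fin n ⊕ Fin n

/-- The `n²` possible edges: `(i, j)` joins the `i`-th vertex of `L` to the `j`-th vertex of `R`. -/
abbrev BipEdge (n : ℕ) : Type := Fin n × Fin n

/-- The bipartite graph on `L ∪ R` whose edges are the pairs marked `true` by `A`. -/
def bipGraph {n : ℕ} (A : BipEdge n → Bool) : SimpleGraph (BipVertex n) where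
  Adj u v :=
    (∃ i j, u = Sum.inl i ∧ v = Sum.inr j ∧ A (i, j) = true) ∨
    (∃ i j, v = Sum.inl i ∧ u = Sum.inr j ∧ A (i, j) = true)
  symm := ⟨fun _ _ h => h.symm⟩
  loopless := ⟨fun u h => by
    rcases h with ⟨i, j, h1, h2, -⟩ | ⟨i, j, h1, h2, -⟩ <;> simp [h1] at h2⟩

/-- The 0/1 vector in `ℝ^(n²)` that encodes the edge set `A`. -/
def edgeVector {n : ℕ} (A : BipEdge n → Bool) : BipEdge n → ℝ :=
  fun e => if A e = true then 1 else 0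

/-- The edge probability `d / n`, truncated to `[0, 1]` (it equals `d / n` when `0 ≤ d ≤ n`). -/
def edgeProb (n : ℕ) (d : ℝ) : unitInterval :=
  Set.projIcc (0 : ℝ) 1 zero_le_one (d / n)

/-- The law of the random bipartite graph: every pair in `L × R` is an edge independently
with probability `d / n`. -/
def randomBip (n : ℕ) (d : ℝ) : Measure (BipEdge n → Bool) :=
  Measure.pi fun _ => bernoulliMeasure true false (edgeProb n d)

open Classical in
/-- `I`: the coordinates of the output `x` that are at least `1`. -/
def roundI {n : ℕ} (x : BipVertex n → ℝ) : Finset (BipVertex n) :=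
  Finset.univ.filter fun v => 1 ≤ x v

open Classical in
/-- The vertices of `I` without neighbours in `I`. -/
def roundITilde {n : ℕ} (A : BipEdge n → Bool) (x : BipVertex n → ℝ) : Finset (BipVertex n) :=
  (roundI x).filter fun v => ∀ w ∈ roundI x, ¬ (bipGraph A).Adj v w

open Classical in
/-- `J`: the coordinates of `x` that lie strictly between `1/2` and `1`. -/
def roundJ {n : ℕ} (x : BipVertex n → ℝ) : Finset (BipVertex n) :=
  Finset.univ.filter fun v => 1 / 2 < x v ∧ x v < 1

open Classical in
/-- The independent set `V^η` obtained by rounding the output `x` on the graph `A`. -/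
def roundedSet {n : ℕ} (η : ℝ) (A : BipEdge n → Bool) (x : BipVertex n → ℝ) :
    Finset (BipVertex n) :=
  if (((roundI x \ roundITilde A x).card + (roundJ x).card : ℕ) : ℝ) ≤ η * n
  then roundITilde A x else ∅

/-- `|S ∩ L|`. -/
def leftCard {n : ℕ} (S : Finset (BipVertex n)) : ℕ := (S.filter fun v => v.isLeft = true).card

/-- `|S ∩ R|`. -/
def rightCard {n : ℕ} (S : Finset (BipVertex n)) : ℕ := (S.filter fun v => v.isRight = true).card

/-- A vector of `2n` real polynomials in the `n²` edge variables. -/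
abbrev BipPoly (n : ℕ) : Type := BipVertex n → MvPolynomial (BipEdge n) ℝ

/-- The value of a polynomial vector at the 0/1 encoding of a graph. -/
def BipPoly.value {n : ℕ} (f : BipPoly n) (A : BipEdge n → Bool) : BipVertex n → ℝ :=
  fun v => MvPolynomial.eval (edgeVector A) (f v)

/-- Every coordinate polynomial has degree at most `D`. -/
def BipPoly.DegreeLE {n : ℕ} (f : BipPoly n) (D : ℕ) : Prop :=
  ∀ v, (f v).totalDegree ≤ D

/-- A random polynomial of degree at most `D`: each realization has degree at most `D`, and the
coefficients are random variables on `Ω`. -/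
structure IsRandomPoly {Ω : Type*} [MeasurableSpace Ω] {n : ℕ} (D : ℕ) (f : Ω → BipPoly n) :
    Prop where
  degreeLE : ∀ ω, (f ω).DegreeLE D
  measurable_coeff : ∀ v m, Measurable fun ω => (f ω v).coeff m

/-- `f` `(kl, kr, δ, ξ, η)`-optimizes the independent set problem in the random bipartite graph;
the graph `A` and the internal randomness `ω ∼ P` are independent. -/
def Optimizes {Ω : Type*} [MeasurableSpace Ω] (P : Measure Ω) (n : ℕ) (d kl kr δ ξ η : ℝ)
    (f : Ω → BipPoly n) : Prop :=
  (∫⁻ z, ENNReal.ofReal (∑ v, (f z.2).value z.1 v ^ 2) ∂((randomBip n d).prod P)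
      ≤ ENNReal.ofReal (ξ * (kl + kr))) ∧
  ENNReal.ofReal (1 - δ) ≤ ((randomBip n d).prod P)
    {z | kl ≤ leftCard (roundedSet η z.1 ((f z.2).value z.1)) ∧
         kr ≤ rightCard (roundedSet η z.1 ((f z.2).value z.1))}

/-- A deterministic polynomial optimizes, i.e. the internal randomness is trivial. -/
def DetOptimizes (n : ℕ) (d kl kr δ ξ η : ℝ) (F : BipPoly n) : Prop :=
  Optimizes (Measure.dirac ()) n d kl kr δ ξ η fun _ => F

end

/-!
Hardness. Resample the `n²` potential edges one at a time, for a bounded number of sweeps. A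
polynomial of degree `D` has total influence at most `D` times its energy, so by Jensen's inequality
the resulting path of graphs avoids every edge of the cube across which the output jumps a lot, with
probability at least `exp (-O(ξ D log n))`. If rounding moreover succeeds at all times, the rounded
sets move slowly, and one can pick along the path a chain of large independent sets, each meeting
the union of its predecessors in an intermediate number of vertices; otherwise a large part of the
union is independent in a graph all of whose edges have been resampled. A first moment computation
shows that, at side density `(1 + ε) log d / d`, both events have probability `exp (-Ω(n))`. Hence
rounding fails with probability more than `exp (-C₂ ξ D log n)`. Internal randomness is removed
first, by Markov's inequality.

Achievability. Fix `S ⊆ L` and `T ⊆ R` in advance. The affine map that is `1` on `S` and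
`1 - #(neighbours of v in S)` at `v ∈ T` rounds to `S` together with the vertices of `T` that have
no neighbour in `S`; for `#S ≤ (1 - ε) n log d / d` there are about `#T d ^ (ε - 1)` of these or
more, by Chebyshev's inequality.
-/

/-! ### Products of Bernoulli measures -/

/-- The law of a family of independent bits, each of them `true` with probability `p`. -/
noncomputable def bernoulliCube (ι : Type*) [Fintype ι] (p : unitInterval) :
    Measure (ι → Bool) :=
  Measure.pi fun _ => bernoulliMeasure true false p

instance (ι : Type*) [Fintype ι] (p : unitInterval) : IsProbabilityMeasure (bernoulliCube ι p) := by
  unfold bernoulliCube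
  infer_instance

/-- The average of `F` over the two values of the bit `i`, the other bits of `x` being kept. -/
def resample {ι : Type*} [DecidableEq ι] (p : unitInterval) (i : ι) (F : (ι → Bool) → ℝ)
    (x : ι → Bool) : ℝ :=
  p * F (Function.update x i true) + (1 - p) * F (Function.update x i false)

section BernoulliCube

variable {ι κ : Type*} [Fintype ι] [Fintype κ] {p : unitInterval}

lemma measurePreserving_update_pi [DecidableEq ι] {α : ι → Type*} [∀ i, MeasurableSpace (α i)]
    (μ : ∀ i, Measure (α i)) [∀ i, IsProbabilityMeasure (μ i)] (i : ι) :
    MeasurePreserving (fun z : (∀ j, α j) × α i => Function.update z.1 i z.2)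
      ((Measure.pi μ).prod (μ i)) (Measure.pi μ) := by
  have hmeas : Measurable fun z : (∀ j, α j) × α i => Function.update z.1 i z.2 := by fun_prop
  refine ⟨hmeas, (Measure.pi_eq fun s hs => ?_).symm⟩
  have hpre : (fun z : (∀ j, α j) × α i => Function.update z.1 i z.2) ⁻¹' Set.univ.pi s =
      Set.univ.pi (Function.update s i Set.univ) ×ˢ s i := by
    ext ⟨x, b⟩
    simp only [Set.mem_preimage, Set.mem_univ_pi, Set.mem_prod]
    constructor
    · refine fun h => ⟨fun j => ?_, by simpa using h i⟩
      rcases eq_or_ne j i with rfl | hj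
      · simp
      · simpa [hj] using h j
    · rintro ⟨hx, hb⟩ j
      rcases eq_or_ne j i with rfl | hj
      · simpa using hb
      · simpa [hj] using hx j
  rw [Measure.map_apply hmeas (MeasurableSet.univ_pi hs), hpre, Measure.prod_prod, Measure.pi_pi,
    ← Finset.prod_erase_mul _ (fun j => μ j (s j)) (Finset.mem_univ i),
    ← Finset.prod_erase_mul _ (fun j => μ j (Function.update s i Set.univ j)) (Finset.mem_univ i)]
  simp only [Function.update_self, measure_univ, mul_one]
  congr 1
  exact Finset.prod_congr rfl fun j hj => by rw [Function.update_of_ne (Finset.ne_of_mem_erase hj)]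

lemma integral_resample [DecidableEq ι] (i : ι) (F : (ι → Bool) → ℝ) :
    ∫ x, resample p i F x ∂bernoulliCube ι p = ∫ x, F x ∂bernoulliCube ι p := by
  have hmp := measurePreserving_update_pi (fun _ : ι => bernoulliMeasure true false p) i
  rw [bernoulliCube]
  nth_rw 2 [← hmp.map_eq]
  rw [integral_map_of_stronglyMeasurable hmp.measurable .of_discrete, integral_prod _ .of_finite]
  simp [integral_bernoulliMeasure, resample]

lemma integral_prod_bernoulliCube (g : ι → Bool → ℝ) :
    ∫ x, ∏ i, g i (x i) ∂bernoulliCube ι p = ∏ i, (p * g i true + (1 - p) * g i false) := by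
  rw [bernoulliCube, integral_fintype_prod_eq_prod]
  simp [integral_bernoulliMeasure]

lemma measurePreserving_comp_of_injective {g : ι → κ} (hg : Function.Injective g) :
    MeasurePreserving (fun y : κ → Bool => y ∘ g) (bernoulliCube κ p) (bernoulliCube ι p) := by
  refine ⟨.of_discrete, ?_⟩
  have hindep : iIndepFun (fun i (y : κ → Bool) => y (g i)) (bernoulliCube κ p) :=
    (iIndepFun_pi (μ := fun _ : κ => bernoulliMeasure true false p) (X := fun _ b => b)
      fun _ => aemeasurable_id).precomp hg
  have hmap := (iIndepFun_iff_map_fun_eq_pi_map fun i =>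
    (measurable_pi_apply (g i)).aemeasurable).1 hindep
  simp only [bernoulliCube, (measurePreserving_eval _ _).map_eq] at hmap
  exact hmap

lemma measureReal_bernoulliCube_forall_false (U : Finset ι) :
    (bernoulliCube ι p).real {x | ∀ u ∈ U, x u = false} = (1 - p) ^ U.card := by
  have hset : {x : ι → Bool | ∀ u ∈ U, x u = false} = (U : Set ι).pi fun _ => {false} := by
    ext x
    simp
  rw [hset, bernoulliCube, ← Measure.infinitePi_eq_pi, Measure.real,
    Measure.infinitePi_pi _ fun _ _ => MeasurableSet.singleton _]
  simp [bernoulliMeasure]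

lemma measureReal_exists_mem_le {Ω α : Type*} [MeasurableSpace Ω] (μ : Measure Ω)
    [IsFiniteMeasure μ] (s : Finset α) (E : α → Ω → Prop) :
    μ.real {x | ∃ a ∈ s, E a x} ≤ ∑ a ∈ s, μ.real {x | E a x} := by
  have hset : {x | ∃ a ∈ s, E a x} = ⋃ a ∈ s, {x | E a x} := by
    ext x
    simp
  rw [hset]
  exact measureReal_biUnion_finset_le _ _

end BernoulliCube

/-! ### Total influence of low-degree functions -/

/-- The character `∏ i ∈ S, (x i - p)` of the `p`-biased cube. It is not normalized: its second
moment is `(p (1 - p)) ^ #S`. -/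
noncomputable def cubeChar {ι : Type*} (p : unitInterval) (S : Finset ι) (x : ι → Bool) : ℝ :=
  ∏ i ∈ S, ((if x i = true then 1 else 0) - p)

/-- The discrete derivative of `f` in direction `i`. -/
def cubeDeriv {ι : Type*} [DecidableEq ι] (i : ι) (f : (ι → Bool) → ℝ) (x : ι → Bool) : ℝ :=
  f (Function.update x i true) - f (Function.update x i false)

/-- The functions of degree at most `D` on the cube, as the span of the characters of the sets of
at most `D` bits. -/
def lowDegree {ι : Type*} [Fintype ι] (p : unitInterval) (D : ℕ) :
    Submodule ℝ ((ι → Bool) → ℝ) :=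
  Submodule.span ℝ (cubeChar p '' {S | S.card ≤ D})

section Influence

variable {ι : Type*} {p : unitInterval} {D : ℕ}

lemma integral_cubeChar_mul_cubeChar [Fintype ι] [DecidableEq ι] (S T : Finset ι) :
    ∫ x, cubeChar p S x * cubeChar p T x ∂bernoulliCube ι p =
      if S = T then ((p : ℝ) * (1 - p)) ^ S.card else 0 := by
  have h := integral_prod_bernoulliCube (p := p) fun (i : ι) b =>
    (if i ∈ S then (if b = true then (1 : ℝ) else 0) - p else 1) *
      (if i ∈ T then (if b = true then (1 : ℝ) else 0) - p else 1)
  simp only [Finset.prod_mul_distrib, Finset.prod_ite_mem, Finset.univ_inter] at h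
  simp only [cubeChar]
  rw [h]
  rcases eq_or_ne S T with rfl | hST
  · rw [if_pos rfl, ← Finset.prod_const, ← Finset.prod_subset (Finset.subset_univ S)]
    · refine Finset.prod_congr rfl fun i hi => ?_
      simp only [hi, if_true, Bool.false_eq_true, if_false]
      ring
    · intro i _ hi
      simp [hi]
  · rw [if_neg hST]
    obtain ⟨i, hi⟩ : ∃ i, ¬(i ∈ S ↔ i ∈ T) := by
      by_contra! hcon
      exact hST (Finset.ext hcon)
    refine Finset.prod_eq_zero (Finset.mem_univ i) ?_
    by_cases hiS : i ∈ S <;> by_cases hiT : i ∈ T <;> simp [hiS, hiT] at hi ⊢ <;> ring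

lemma integral_sq_sum_cubeChar [Fintype ι] {α : Type*} (A : Finset α) (c : α → ℝ)
    (h : α → Finset ι) (hinj : Set.InjOn h A) :
    ∫ x, (∑ a ∈ A, c a * cubeChar p (h a) x) ^ 2 ∂bernoulliCube ι p =
      ∑ a ∈ A, c a ^ 2 * ((p : ℝ) * (1 - p)) ^ (h a).card := by
  classical
  have hexpand : ∀ x, (∑ a ∈ A, c a * cubeChar p (h a) x) ^ 2 =
      ∑ a ∈ A, ∑ b ∈ A, c a * c b * (cubeChar p (h a) x * cubeChar p (h b) x) := by
    intro x
    rw [sq, Finset.sum_mul_sum]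
    exact Finset.sum_congr rfl fun a _ => Finset.sum_congr rfl fun b _ => by ring
  simp only [hexpand, integral_finsetSum _ fun _ _ => Integrable.of_finite, integral_const_mul,
    integral_cubeChar_mul_cubeChar]
  refine Finset.sum_congr rfl fun a ha => ?_
  rw [Finset.sum_eq_single_of_mem a ha fun b hb hab => ?_]
  · simp [sq]
  · rw [if_neg fun hh => hab (hinj ha hb hh).symm, mul_zero]

lemma cubeChar_update_of_notMem [DecidableEq ι] {i : ι} {S : Finset ι} (hi : i ∉ S)
    (x : ι → Bool) (b : Bool) :
    cubeChar p S (Function.update x i b) = cubeChar p S x :=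
  Finset.prod_congr rfl fun j hj => by rw [Function.update_of_ne (ne_of_mem_of_not_mem hj hi)]

lemma cubeDeriv_cubeChar [DecidableEq ι] (i : ι) (S : Finset ι) (x : ι → Bool) :
    cubeDeriv i (cubeChar p S) x = if i ∈ S then cubeChar p (S.erase i) x else 0 := by
  split_ifs with hi
  · have hsplit : ∀ y, cubeChar p S y =
        ((if y i = true then 1 else 0) - p) * cubeChar p (S.erase i) y := fun y =>
      (Finset.mul_prod_erase S _ hi).symm
    simp [cubeDeriv, hsplit, cubeChar_update_of_notMem]
    ring
  · simp [cubeDeriv, cubeChar_update_of_notMem hi]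

lemma mem_lowDegree_iff [Fintype ι] {f : (ι → Bool) → ℝ} :
    f ∈ lowDegree p D ↔ ∃ c : Finset ι → ℝ,
      f = fun x => ∑ S ∈ Finset.univ.filter (·.card ≤ D), c S * cubeChar p S x := by
  have hset : {S : Finset ι | S.card ≤ D} =
      ↑(Finset.univ.filter fun S : Finset ι => S.card ≤ D) := by
    ext S
    simp
  rw [lowDegree, hset, Submodule.mem_span_image_finset_iff_exists_fun']
  refine exists_congr fun c => ?_
  rw [eq_comm]
  refine Eq.congr_right (funext fun x => ?_)
  simp

lemma integral_sq_cubeDeriv_sum [Fintype ι] [DecidableEq ι] (𝒮 : Finset (Finset ι))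
    (c : Finset ι → ℝ) (i : ι) :
    p * (1 - p) * ∫ x, cubeDeriv i (fun y => ∑ S ∈ 𝒮, c S * cubeChar p S y) x ^ 2
        ∂bernoulliCube ι p =
      ∑ S ∈ 𝒮.filter (i ∈ ·), c S ^ 2 * ((p : ℝ) * (1 - p)) ^ S.card := by
  have hderiv : ∀ x, cubeDeriv i (fun y => ∑ S ∈ 𝒮, c S * cubeChar p S y) x =
      ∑ S ∈ 𝒮.filter (i ∈ ·), c S * cubeChar p (S.erase i) x := by
    intro x
    rw [Finset.sum_filter]
    calc _ = ∑ S ∈ 𝒮, c S * cubeDeriv i (cubeChar p S) x := by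
          simp only [cubeDeriv, ← Finset.sum_sub_distrib, mul_sub]
      _ = _ := Finset.sum_congr rfl fun S _ => by
          rw [cubeDeriv_cubeChar]
          split_ifs <;> simp
  simp only [hderiv]
  rw [integral_sq_sum_cubeChar _ c (fun S => S.erase i), Finset.mul_sum]
  · refine Finset.sum_congr rfl fun S hS => ?_
    rw [← Finset.card_erase_add_one (Finset.mem_filter.1 hS).2, pow_succ]
    ring
  · intro S hS T hT hST
    dsimp only at hST
    rw [← Finset.insert_erase (Finset.mem_filter.1 hS).2,
      ← Finset.insert_erase (Finset.mem_filter.1 hT).2, hST]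

lemma total_influence_le [Fintype ι] [DecidableEq ι] {f : (ι → Bool) → ℝ} (hf : f ∈ lowDegree p D) :
    ∑ i, p * (1 - p) * ∫ x, cubeDeriv i f x ^ 2 ∂bernoulliCube ι p ≤
      D * ∫ x, f x ^ 2 ∂bernoulliCube ι p := by
  obtain ⟨c, rfl⟩ := mem_lowDegree_iff.1 hf
  have hp : 0 ≤ (p : ℝ) * (1 - p) := mul_nonneg p.2.1 (by linarith [p.2.2])
  simp only [integral_sq_cubeDeriv_sum, Finset.sum_filter (_ ∈ ·)]
  have hsecond := integral_sq_sum_cubeChar (p := p) (Finset.univ.filter (·.card ≤ D)) c id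
    Function.injective_id.injOn
  simp only [id] at hsecond
  rw [Finset.sum_comm, hsecond, Finset.mul_sum]
  refine Finset.sum_le_sum fun S hS => ?_
  have hcard : (S.card : ℝ) ≤ D := by exact_mod_cast (Finset.mem_filter.1 hS).2
  rw [← Finset.sum_filter, Finset.sum_const, nsmul_eq_mul, Finset.filter_univ_mem]
  exact mul_le_mul_of_nonneg_right hcard (mul_nonneg (sq_nonneg _) (pow_nonneg hp _))

lemma prod_bits_mem_lowDegree [Fintype ι] {S : Finset ι} (hS : S.card ≤ D) :
    (fun x : ι → Bool => ∏ i ∈ S, if x i = true then (1 : ℝ) else 0) ∈ lowDegree p D := by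
  classical
  have hexpand : (fun x : ι → Bool => ∏ i ∈ S, if x i = true then (1 : ℝ) else 0) =
      ∑ T ∈ S.powerset, (p : ℝ) ^ (S \ T).card • cubeChar p T := by
    funext x
    simp only [Finset.sum_apply, Pi.smul_apply, smul_eq_mul, cubeChar, ← Finset.prod_const,
      mul_comm (∏ _ ∈ _ \ _, _), ← Finset.prod_add, sub_add_cancel]
  rw [hexpand]
  refine Submodule.sum_mem _ fun T hT => Submodule.smul_mem _ _ (Submodule.subset_span ⟨T, ?_, rfl⟩)
  exact (Finset.card_le_card (Finset.mem_powerset.1 hT)).trans hS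

lemma eval_bits_mem_lowDegree [Fintype ι] {F : MvPolynomial ι ℝ} (hF : F.totalDegree ≤ D) :
    (fun x : ι → Bool => MvPolynomial.eval (fun i => if x i = true then (1 : ℝ) else 0) F) ∈
      lowDegree p D := by
  have hsum : (fun x : ι → Bool =>
        MvPolynomial.eval (fun i => if x i = true then (1 : ℝ) else 0) F) =
      ∑ m ∈ F.support, F.coeff m • fun x : ι → Bool =>
        ∏ i ∈ m.support, if x i = true then (1 : ℝ) else 0 := by
    funext x
    simp only [MvPolynomial.eval_eq, Finset.sum_apply, Pi.smul_apply, smul_eq_mul, ite_pow,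
      one_pow]
    refine Finset.sum_congr rfl fun m _ => congrArg _ (Finset.prod_congr rfl fun i hi => ?_)
    rw [zero_pow (Finsupp.mem_support_iff.1 hi)]
  rw [hsum]
  refine Submodule.sum_mem _ fun m hm => Submodule.smul_mem _ _ (prod_bits_mem_lowDegree ?_)
  calc m.support.card = ∑ i ∈ m.support, 1 := Finset.card_eq_sum_ones _
    _ ≤ ∑ i ∈ m.support, m i :=
      Finset.sum_le_sum fun i hi => Nat.one_le_iff_ne_zero.2 (Finsupp.mem_support_iff.1 hi)
    _ ≤ D := (MvPolynomial.le_totalDegree hm).trans hF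

end Influence

/-! ### The resampling path -/

/-- The last time `≤ t` at which the coordinate `e` was resampled, when the coordinate `σ j` is
resampled at time `j + 1`; it is `0` if `e` was not resampled yet. -/
def lastTime {E : Type*} [DecidableEq E] (σ : ℕ → E) : ℕ → E → ℕ
  | 0 => fun _ => 0
  | t + 1 => Function.update (lastTime σ t) (σ t) (t + 1)

/-- The independent bit that the coordinate `e` of the path shows at time `t ≤ T`. -/
def pathCoord {E : Type*} [DecidableEq E] (T : ℕ) (σ : ℕ → E) (t : ℕ) (e : E) :
    Fin (T + 1) × E :=
  (Fin.ofNat (T + 1) (lastTime σ t e), e)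

/-- The state at time `t ≤ T` of the path that resamples the coordinate `σ j` at time `j + 1`, as a
function of independent bits `ω`, where `ω (t, e)` is the value given to `e` at time `t`. -/
def pathState {E : Type*} [DecidableEq E] {T : ℕ} (σ : ℕ → E) (ω : Fin (T + 1) × E → Bool)
    (t : ℕ) : E → Bool :=
  fun e => ω (pathCoord T σ t e)

/-- Up to time `t`, the path never moves along a bad edge; `Bad e x` says that the edge in
direction `e` at `x` is bad. -/
def AvoidsBad {E : Type*} [DecidableEq E] {T : ℕ} (σ : ℕ → E) (Bad : E → (E → Bool) → Prop)
    (ω : Fin (T + 1) × E → Bool) (t : ℕ) : Prop :=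
  ∀ j < t, Bad (σ j) (pathState σ ω j) → pathState σ ω (j + 1) = pathState σ ω j

open Classical in
/-- The transition operator of the path that resamples the bit `e` and is killed when it moves
along a bad edge. -/
noncomputable def guardedStep {E : Type*} [DecidableEq E] (p : unitInterval) (e : E)
    (Bad : (E → Bool) → Prop) (g : (E → Bool) → ℝ) (x : E → Bool) : ℝ :=
  if Bad x then (if x e = true then (p : ℝ) else 1 - p) * g x else resample p e g x

/-- The cyclic enumeration of a finite type. -/
noncomputable def sweep (E : Type*) [Fintype E] [Nonempty E] (t : ℕ) : E :=
  (Fintype.equivFin E).symm (Fin.ofNat (Fintype.card E) t)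

section PathState

variable {E : Type*} [DecidableEq E] {T : ℕ} {σ : ℕ → E} {p : unitInterval}

lemma lastTime_le (t : ℕ) (e : E) : lastTime σ t e ≤ t := by
  induction t with
  | zero => simp [lastTime]
  | succ t ih =>
    rcases eq_or_ne e (σ t) with rfl | h
    · simp [lastTime]
    · rw [lastTime, Function.update_of_ne h]
      exact Nat.le_succ_of_le ih

lemma lt_lastTime {t₀ j t : ℕ} (h₀ : t₀ ≤ j) (h : j < t) : t₀ < lastTime σ t (σ j) := by
  induction t with
  | zero => exact absurd h j.not_lt_zero
  | succ t ih =>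
    by_cases hj : σ j = σ t
    · rw [lastTime, hj, Function.update_self]
      omega
    · rw [lastTime, Function.update_of_ne hj]
      exact ih (lt_of_le_of_ne (Nat.le_of_lt_succ h) fun hjt => hj (hjt ▸ rfl))

lemma pathCoord_injective (t : ℕ) : Function.Injective (pathCoord T σ t) :=
  fun _ _ h => congrArg Prod.snd h

lemma pathState_succ (ω : Fin (T + 1) × E → Bool) (t : ℕ) :
    pathState σ ω (t + 1) =
      Function.update (pathState σ ω t) (σ t) (ω (Fin.ofNat (T + 1) (t + 1), σ t)) := by
  ext e
  rcases eq_or_ne e (σ t) with rfl | h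
  · simp [pathState, pathCoord, lastTime]
  · simp [pathState, pathCoord, lastTime, Function.update_of_ne h]

lemma pathState_update (ω : Fin (T + 1) × E → Bool) {j t : ℕ} (hj : j ≤ t) (ht : t < T) (b : Bool) :
    pathState σ (Function.update ω (Fin.ofNat (T + 1) (t + 1), σ t) b) j = pathState σ ω j := by
  ext e
  refine Function.update_of_ne (fun h => ?_) _ _
  have hval : lastTime σ j e % (T + 1) = (t + 1) % (T + 1) :=
    congrArg (fun z : Fin (T + 1) × E => z.1.val) h
  have hle := lastTime_le (σ := σ) j e
  rw [Nat.mod_eq_of_lt (by omega), Nat.mod_eq_of_lt (by omega)] at hval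
  omega

lemma avoidsBad_succ_iff {Bad : E → (E → Bool) → Prop} {ω : Fin (T + 1) × E → Bool} {t : ℕ} :
    AvoidsBad σ Bad ω (t + 1) ↔ AvoidsBad σ Bad ω t ∧
      (Bad (σ t) (pathState σ ω t) → pathState σ ω (t + 1) = pathState σ ω t) :=
  Nat.forall_lt_succ_right

lemma avoidsBad_update (Bad : E → (E → Bool) → Prop) (ω : Fin (T + 1) × E → Bool) {t : ℕ}
    (ht : t < T) (b : Bool) :
    AvoidsBad σ Bad (Function.update ω (Fin.ofNat (T + 1) (t + 1), σ t) b) t ↔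
      AvoidsBad σ Bad ω t := by
  refine forall₂_congr fun j hj => ?_
  rw [pathState_update ω hj.le ht, pathState_update ω hj ht]

lemma guardedStep_pos (h0 : 0 < (p : ℝ)) (h1 : (p : ℝ) < 1) (e : E) (Bad : (E → Bool) → Prop)
    {g : (E → Bool) → ℝ} (hg : ∀ x, 0 < g x) (x : E → Bool) : 0 < guardedStep p e Bad g x := by
  have h1' : 0 < 1 - (p : ℝ) := sub_pos.2 h1
  unfold guardedStep resample
  split_ifs
  · exact mul_pos h0 (hg x)
  · exact mul_pos h1' (hg x)
  · exact add_pos (mul_pos h0 (hg _)) (mul_pos h1' (hg _))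

lemma resample_indicator_avoidsBad {t : ℕ} (ht : t < T) (Bad : E → (E → Bool) → Prop)
    (g : (E → Bool) → ℝ) (ω : Fin (T + 1) × E → Bool) :
    resample p (Fin.ofNat (T + 1) (t + 1), σ t)
        ({ω | AvoidsBad σ Bad ω (t + 1)}.indicator fun ω => g (pathState σ ω (t + 1))) ω =
      {ω | AvoidsBad σ Bad ω t}.indicator
        (fun ω => guardedStep p (σ t) (Bad (σ t)) g (pathState σ ω t)) ω := by
  classical
  simp only [resample, Set.indicator_apply, Set.mem_ofPred_eq, avoidsBad_succ_iff, pathState_succ,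
    avoidsBad_update _ _ ht, pathState_update ω le_rfl ht, Function.update_self, guardedStep,
    Function.update_eq_self_iff]
  by_cases hA : AvoidsBad σ Bad ω t
  · by_cases hb : Bad (σ t) (pathState σ ω t)
    · have hself := Function.update_eq_self (σ t) (pathState σ ω t)
      cases hx : pathState σ ω t (σ t) <;> rw [hx] at hself <;> simp [hA, hb, hself]
    · simp [hA, hb]
  · simp [hA]

end PathState

section AvoidsBad

variable {E : Type*} [Fintype E] [DecidableEq E] {T : ℕ} {σ : ℕ → E} {p : unitInterval}

lemma measurePreserving_pathState (t : ℕ) :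
    MeasurePreserving (fun ω : Fin (T + 1) × E → Bool => pathState σ ω t)
      (bernoulliCube (Fin (T + 1) × E) p) (bernoulliCube E p) :=
  measurePreserving_comp_of_injective (pathCoord_injective t)

lemma integral_log_sub_le_integral_log_guardedStep (h0 : 0 < (p : ℝ)) (h1 : (p : ℝ) < 1) (e : E)
    {Bad : (E → Bool) → Prop} (hBad : ∀ x b, Bad (Function.update x e b) ↔ Bad x)
    {g : (E → Bool) → ℝ} (hg : ∀ x, 0 < g x) :
    ∫ x, Real.log (g x) ∂bernoulliCube E p -
        Real.binEntropy p * (bernoulliCube E p).real {x | Bad x} ≤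
      ∫ x, Real.log (guardedStep p e Bad g x) ∂bernoulliCube E p := by
  classical
  have h1' : 0 < 1 - (p : ℝ) := sub_pos.2 h1
  set h : (E → Bool) → ℝ := fun x =>
    if Bad x then Real.log (if x e = true then (p : ℝ) else 1 - p) + Real.log (g x)
    else resample p e (fun y => Real.log (g y)) x with hh
  have hle : ∀ x, h x ≤ Real.log (guardedStep p e Bad g x) := by
    intro x
    simp only [hh, guardedStep]
    split_ifs
    · rw [Real.log_mul h0.ne' (hg x).ne']
    · rw [Real.log_mul h1'.ne' (hg x).ne']
    · exact strictConcaveOn_log_Ioi.concaveOn.2 (Set.mem_Ioi.2 (hg (Function.update x e true)))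
        (Set.mem_Ioi.2 (hg (Function.update x e false))) h0.le h1'.le (by ring)
  have hresample : ∀ x, resample p e h x = resample p e (fun y => Real.log (g y)) x -
      Real.binEntropy p * Set.indicator {y | Bad y} 1 x := by
    intro x
    by_cases hb : Bad x
    · simp [hh, resample, hBad, hb, Real.binEntropy, Real.log_inv]
      ring
    · simp [hh, resample, hBad, hb]
      ring
  calc ∫ x, Real.log (g x) ∂bernoulliCube E p -
        Real.binEntropy p * (bernoulliCube E p).real {x | Bad x}
      = ∫ x, resample p e h x ∂bernoulliCube E p := by
        simp only [hresample]
        rw [integral_sub .of_finite .of_finite, integral_resample, integral_const_mul,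
          integral_indicator_one .of_discrete]
    _ = ∫ x, h x ∂bernoulliCube E p := integral_resample e h
    _ ≤ _ := integral_mono .of_finite .of_finite hle

lemma setIntegral_avoidsBad_succ {t : ℕ} (ht : t < T) (Bad : E → (E → Bool) → Prop)
    (g : (E → Bool) → ℝ) :
    ∫ ω in {ω | AvoidsBad σ Bad ω (t + 1)}, g (pathState σ ω (t + 1))
        ∂bernoulliCube (Fin (T + 1) × E) p =
      ∫ ω in {ω | AvoidsBad σ Bad ω t}, guardedStep p (σ t) (Bad (σ t)) g (pathState σ ω t)
        ∂bernoulliCube (Fin (T + 1) × E) p := by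
  rw [← integral_indicator .of_discrete, ← integral_indicator .of_discrete,
    ← integral_resample (Fin.ofNat (T + 1) (t + 1), σ t)]
  simp only [resample_indicator_avoidsBad ht]

-- Backward induction on the killed path, with Jensen's inequality for `exp` at time `0`.
lemma exp_le_setIntegral_avoidsBad (h0 : 0 < (p : ℝ)) (h1 : (p : ℝ) < 1)
    {Bad : E → (E → Bool) → Prop} (hBad : ∀ e x b, Bad e (Function.update x e b) ↔ Bad e x)
    {t : ℕ} (ht : t ≤ T) {g : (E → Bool) → ℝ} (hg : ∀ x, 0 < g x) :
    Real.exp (∫ x, Real.log (g x) ∂bernoulliCube E p -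
        Real.binEntropy p * ∑ j ∈ Finset.range t, (bernoulliCube E p).real {x | Bad (σ j) x}) ≤
      ∫ ω in {ω | AvoidsBad σ Bad ω t}, g (pathState σ ω t)
        ∂bernoulliCube (Fin (T + 1) × E) p := by
  induction t generalizing g with
  | zero =>
    have huniv : {ω : Fin (T + 1) × E → Bool | AvoidsBad σ Bad ω 0} = Set.univ := by
      ext ω
      simp [AvoidsBad]
    have hmp := measurePreserving_pathState (T := T) (σ := σ) (p := p) 0
    have hjensen := convexOn_exp.map_integral_le (μ := bernoulliCube E p)
      (f := fun x => Real.log (g x)) Real.continuous_exp.continuousOn isClosed_univ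
      (.of_forall fun _ => Set.mem_univ _) .of_finite .of_finite
    simp only [Real.exp_log (hg _)] at hjensen
    rw [huniv, setIntegral_univ,
      ← integral_map_of_stronglyMeasurable hmp.measurable .of_discrete, hmp.map_eq]
    simpa using hjensen
  | succ t ih =>
    have hstep := integral_log_sub_le_integral_log_guardedStep h0 h1 (σ t) (hBad (σ t)) hg
    rw [setIntegral_avoidsBad_succ ht]
    refine le_trans (Real.exp_le_exp.2 ?_)
      (ih (Nat.le_of_succ_le ht) (guardedStep_pos h0 h1 (σ t) (Bad (σ t)) hg))
    rw [Finset.sum_range_succ, mul_add]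
    linarith

lemma exp_le_measureReal_avoidsBad (h0 : 0 < (p : ℝ)) (h1 : (p : ℝ) < 1)
    {Bad : E → (E → Bool) → Prop} (hBad : ∀ e x b, Bad e (Function.update x e b) ↔ Bad e x) :
    Real.exp (-(Real.binEntropy p *
        ∑ j ∈ Finset.range T, (bernoulliCube E p).real {x | Bad (σ j) x})) ≤
      (bernoulliCube (Fin (T + 1) × E) p).real {ω | AvoidsBad σ Bad ω T} := by
  have h := exp_le_setIntegral_avoidsBad (σ := σ) h0 h1 hBad (le_refl T) fun _ => one_pos
  simp only [Real.log_one, integral_zero, zero_sub, setIntegral_const, smul_eq_mul, mul_one] at h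
  exact h

end AvoidsBad

section Sweep

variable {E : Type*} [Fintype E] [Nonempty E]

lemma exists_sweep_eq (t₀ : ℕ) (e : E) :
    ∃ j, t₀ ≤ j ∧ j < t₀ + Fintype.card E ∧ sweep E j = e := by
  have hmem : (Fintype.equivFin E e).val ∈
      (Finset.Ico t₀ (t₀ + Fintype.card E)).image (· % Fintype.card E) := by
    rw [Nat.image_Ico_mod]
    exact Finset.mem_range.2 (Fintype.equivFin E e).isLt
  obtain ⟨j, hj, hmod⟩ := Finset.mem_image.1 hmem
  obtain ⟨hj₀, hj₁⟩ := Finset.mem_Ico.1 hj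
  exact ⟨j, hj₀, hj₁, (Equiv.symm_apply_eq _).2 (Fin.ext hmod)⟩

lemma sum_range_sweep (g : E → ℝ) (K : ℕ) :
    ∑ j ∈ Finset.range (K * Fintype.card E), g (sweep E j) = K * ∑ e, g e := by
  induction K with
  | zero => simp
  | succ K ih =>
    have hperiod : ∑ i : Fin (Fintype.card E), g (sweep E (K * Fintype.card E + i)) = ∑ e, g e := by
      refine Fintype.sum_equiv (Fintype.equivFin E).symm _ _ fun i => congrArg g ?_
      refine congrArg _ (Fin.ext ?_)
      simp [Nat.mod_eq_of_lt i.isLt]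
    rw [Nat.succ_mul, Finset.sum_range_add, ih, Finset.sum_range, hperiod]
    push_cast
    ring

end Sweep


/-! ### Chains of overlapping balanced independent sets -/

/-- The pairs in `L × R` with both endpoints in `S`. -/
def pairsIn {n : ℕ} (S : Finset (BipVertex n)) : Finset (BipEdge n) :=
  S.toLeft ×ˢ S.toRight

/-- `S` has `s` vertices on each side. -/
def IsBalanced {n : ℕ} (s : ℕ) (S : Finset (BipVertex n)) : Prop :=
  S.toLeft.card = s ∧ S.toRight.card = s

/-- `S` is balanced of side `s` and overlaps with `W` as in an overlap gap property: at least `q` of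
its vertices are outside `W`, but at most `2 q` on each side. -/
def OverlapsIn {n : ℕ} (s q : ℕ) (W S : Finset (BipVertex n)) : Prop :=
  IsBalanced s S ∧ (S \ W).toLeft.card ≤ 2 * q ∧ (S \ W).toRight.card ≤ 2 * q ∧ q ≤ (S \ W).card

/-- The graph with edge set `pathState σ ω t` has no edge inside `S`. -/
def IndepAt {n T : ℕ} (σ : ℕ → BipEdge n) (ω : Fin (T + 1) × BipEdge n → Bool) (t : ℕ)
    (S : Finset (BipVertex n)) : Prop :=
  (bipGraph (pathState σ ω t)).IsIndepSet S

/-- From time `t₀` on, the path meets `k` balanced independent sets, each of them overlapping with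
the union of `W` and its predecessors, followed by the event `End`. -/
def Chain {n T : ℕ} (σ : ℕ → BipEdge n) (s q : ℕ)
    (End : ℕ → Finset (BipVertex n) → (Fin (T + 1) × BipEdge n → Bool) → Prop) :
    ℕ → ℕ → Finset (BipVertex n) → (Fin (T + 1) × BipEdge n → Bool) → Prop
  | 0, t₀, W, ω => End t₀ W ω
  | k + 1, t₀, W, ω => ∃ t, t₀ ≤ t ∧ t ≤ T ∧ ∃ S, OverlapsIn s q W S ∧ IndepAt σ ω t S ∧
      Chain σ s q End k t (W ∪ S) ω

/-- A chain of `k` independent sets that starts from a balanced independent set at time `0`. -/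
def InitialChain {n T : ℕ} (σ : ℕ → BipEdge n) (s q : ℕ)
    (End : ℕ → Finset (BipVertex n) → (Fin (T + 1) × BipEdge n → Bool) → Prop) (k : ℕ)
    (ω : Fin (T + 1) × BipEdge n → Bool) : Prop :=
  ∃ S, IsBalanced s S ∧ IndepAt σ ω 0 S ∧ Chain σ s q End k 0 S ω

/-- At least `m` steps after `t₀`, some balanced subset of `W` of side `r` is independent. -/
def LateIndep {n T : ℕ} (σ : ℕ → BipEdge n) (m r t₀ : ℕ) (W : Finset (BipVertex n))
    (ω : Fin (T + 1) × BipEdge n → Bool) : Prop :=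
  ∃ t, t₀ + m ≤ t ∧ t ≤ T ∧ ∃ S ⊆ W, IsBalanced r S ∧ IndepAt σ ω t S

/-- The independent bits that decide at time `t` which pairs inside `S` are edges. -/
def pairCoords {n : ℕ} (T : ℕ) (σ : ℕ → BipEdge n) (t : ℕ) (S : Finset (BipVertex n)) :
    Finset (Fin (T + 1) × BipEdge n) :=
  (pairsIn S).image (pathCoord T σ t)

/-- All bits in `U` belong to times `≤ t₀` and to pairs inside `W`. -/
def SupportedIn {n T : ℕ} (U : Finset (Fin (T + 1) × BipEdge n)) (t₀ : ℕ)
    (W : Finset (BipVertex n)) : Prop :=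
  ∀ u ∈ U, u.1.val ≤ t₀ ∧ u.2 ∈ pairsIn W

section PairCoords

variable {n T : ℕ} {σ : ℕ → BipEdge n} {U : Finset (Fin (T + 1) × BipEdge n)} {t₀ t : ℕ}
  {W S : Finset (BipVertex n)}

lemma IsBalanced.card_eq {s : ℕ} (hS : IsBalanced s S) : S.card = 2 * s := by
  rw [← Finset.card_toLeft_add_card_toRight, hS.1, hS.2, two_mul]

lemma IsBalanced.card_pairsIn {s : ℕ} (hS : IsBalanced s S) : (pairsIn S).card = s * s := by
  rw [pairsIn, Finset.card_product, hS.1, hS.2]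

lemma isIndepSet_bipGraph_iff {A : BipEdge n → Bool} :
    (bipGraph A).IsIndepSet S ↔ ∀ e ∈ pairsIn S, A e = false := by
  simp only [SimpleGraph.IsIndepSet, Set.Pairwise, Finset.mem_coe, pairsIn, Finset.mem_product,
    Finset.mem_toLeft, Finset.mem_toRight, Prod.forall, bipGraph]
  constructor
  · intro h i j hij
    simpa using h hij.1 hij.2 (by simp)
  · rintro h u hu v hv - (⟨i, j, rfl, rfl, hA⟩ | ⟨i, j, rfl, rfl, hA⟩)
    · simp [h i j ⟨hu, hv⟩] at hA
    · simp [h i j ⟨hv, hu⟩] at hA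

lemma indepAt_iff {ω : Fin (T + 1) × BipEdge n → Bool} :
    IndepAt σ ω t S ↔ ∀ u ∈ pairCoords T σ t S, ω u = false := by
  rw [IndepAt, isIndepSet_bipGraph_iff, pairCoords, Finset.forall_mem_image]
  rfl

lemma SupportedIn.union_pairCoords (hU : SupportedIn U t₀ W) (ht : t₀ ≤ t) :
    SupportedIn (U ∪ pairCoords T σ t S) t (W ∪ S) := by
  have hmono {A B : Finset (BipVertex n)} (h : A ⊆ B) : pairsIn A ⊆ pairsIn B :=
    Finset.product_subset_product (Finset.toLeft_subset_toLeft h) (Finset.toRight_subset_toRight h)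
  intro u hu
  rcases Finset.mem_union.1 hu with hu | hu
  · exact ⟨(hU u hu).1.trans ht, hmono Finset.subset_union_left (hU u hu).2⟩
  · obtain ⟨e, he, rfl⟩ := Finset.mem_image.1 hu
    exact ⟨(Nat.mod_le _ _).trans (lastTime_le _ _), hmono Finset.subset_union_right he⟩

lemma card_union_pairCoords (hU : SupportedIn U t₀ W) :
    U.card + (pairsIn S \ pairsIn W).card ≤ (U ∪ pairCoords T σ t S).card := by
  rw [← Finset.card_image_of_injective _ (pathCoord_injective (T := T) (σ := σ) t),
    ← Finset.card_union_of_disjoint]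
  · exact Finset.card_le_card
      (Finset.union_subset_union le_rfl (Finset.image_subset_image Finset.sdiff_subset))
  · rw [Finset.disjoint_right]
    intro u hu hu'
    obtain ⟨e, he, rfl⟩ := Finset.mem_image.1 hu
    exact (Finset.mem_sdiff.1 he).2 (hU _ hu').2

-- After `m` more steps every pair has been resampled, so all bits read inside `S` are new.
lemma card_union_pairCoords_of_late {m : ℕ} (hσ : ∀ t₀ e, ∃ j, t₀ ≤ j ∧ j < t₀ + m ∧ σ j = e)
    (hU : SupportedIn U t₀ W) (ht : t₀ + m ≤ t) (htT : t ≤ T) :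
    (U ∪ pairCoords T σ t S).card = U.card + (pairsIn S).card := by
  rw [Finset.card_union_of_disjoint, pairCoords,
    Finset.card_image_of_injective _ (pathCoord_injective t)]
  rw [Finset.disjoint_right]
  intro u hu hu'
  obtain ⟨e, -, rfl⟩ := Finset.mem_image.1 hu
  obtain ⟨j, hj₀, hjm, rfl⟩ := hσ t₀ e
  have hnew : t₀ < lastTime σ t (σ j) := lt_lastTime hj₀ (by omega)
  have hle := lastTime_le (σ := σ) t (σ j)
  have hold : lastTime σ t (σ j) % (T + 1) ≤ t₀ := (hU _ hu').1
  rw [Nat.mod_eq_of_lt (by omega)] at hold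
  omega

lemma OverlapsIn.mul_card_sdiff_le {s q : ℕ} (hqs : q ≤ s) (h : OverlapsIn s q W S) :
    (s - q) * (S \ W).card ≤ (pairsIn S \ pairsIn W).card := by
  obtain ⟨⟨hL, hR⟩, hx, hy, -⟩ := h
  have hxL := Finset.card_sdiff_add_card_inter S.toLeft W.toLeft
  have hyR := Finset.card_sdiff_add_card_inter S.toRight W.toRight
  have hxy := Finset.card_sdiff_add_card_inter (pairsIn S) (pairsIn W)
  rw [pairsIn, pairsIn, Finset.product_inter_product, Finset.card_product, Finset.card_product,
    hL, hR] at hxy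
  rw [← Finset.card_toLeft_add_card_toRight, Finset.toLeft_sdiff, Finset.toRight_sdiff]
  rw [Finset.toLeft_sdiff] at hx
  rw [Finset.toRight_sdiff] at hy
  rw [hL] at hxL
  rw [hR] at hyR
  simp only [pairsIn]
  zify [hqs] at *
  nlinarith

end PairCoords

lemma sum_pow_card_sdiff_le {α : Type*} [Fintype α] [DecidableEq α] {z : ℝ} (hz : 0 ≤ z)
    (W : Finset α) :
    ∑ S : Finset α, z ^ (S \ W).card ≤ 2 ^ W.card * (1 + z) ^ Fintype.card α := by
  calc ∑ S : Finset α, z ^ (S \ W).card = ∏ a : α, (1 + if a ∈ W then 1 else z) := by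
        rw [Finset.prod_one_add, Finset.powerset_univ]
        refine Finset.sum_congr rfl fun S _ => ?_
        rw [Finset.prod_ite, Finset.prod_const_one, one_mul, Finset.prod_const,
          Finset.sdiff_eq_filter]
    _ ≤ ∏ a : α, ((if a ∈ W then 2 else 1) * (1 + z)) := by
        refine Finset.prod_le_prod (fun a _ => ?_) fun a _ => ?_ <;> split_ifs <;> linarith
    _ = 2 ^ W.card * (1 + z) ^ Fintype.card α := by
        rw [Finset.prod_mul_distrib, Finset.prod_ite_mem, Finset.univ_inter, Finset.prod_const,
          Finset.prod_const, Finset.card_univ]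

lemma choose_mul_pow_le {z : ℝ} (hz : 0 ≤ z) (n s : ℕ) :
    (n.choose s : ℝ) * z ^ s ≤ (1 + z) ^ n := by
  rcases le_or_gt s n with hs | hs
  · calc (n.choose s : ℝ) * z ^ s = z ^ s * 1 ^ (n - s) * n.choose s := by
          rw [one_pow, mul_one, mul_comm]
      _ ≤ ∑ m ∈ Finset.range (n + 1), z ^ m * 1 ^ (n - m) * n.choose m :=
          Finset.single_le_sum (f := fun m => z ^ m * 1 ^ (n - m) * (n.choose m : ℝ))
            (fun m _ => by positivity) (Finset.mem_range.2 (Nat.lt_succ_of_le hs))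
      _ = (1 + z) ^ n := by rw [add_comm 1 z, add_pow]
  · rw [Nat.choose_eq_zero_of_lt hs, Nat.cast_zero, zero_mul]
    positivity

section FirstMoment

variable {n T : ℕ} {σ : ℕ → BipEdge n} {p : unitInterval} {s q N : ℕ}
  {End : ℕ → Finset (BipVertex n) → (Fin (T + 1) × BipEdge n → Bool) → Prop}
  {U : Finset (Fin (T + 1) × BipEdge n)} {t₀ : ℕ} {W : Finset (BipVertex n)}

open Classical in
lemma measureReal_chain_succ_le (k : ℕ) :
    (bernoulliCube (Fin (T + 1) × BipEdge n) p).real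
        {ω | (∀ u ∈ U, ω u = false) ∧ Chain σ s q End (k + 1) t₀ W ω} ≤
      ∑ a ∈ Finset.Icc t₀ T ×ˢ ({S | OverlapsIn s q W S} : Finset (Finset (BipVertex n))),
        (bernoulliCube (Fin (T + 1) × BipEdge n) p).real
          {ω | (∀ u ∈ U ∪ pairCoords T σ a.1 a.2, ω u = false) ∧
            Chain σ s q End k a.1 (W ∪ a.2) ω} := by
  refine le_trans (measureReal_mono ?_) (measureReal_exists_mem_le _ _ _)
  rintro ω ⟨hU, t, ht₀, htT, S, hS, hindep, hchain⟩
  refine ⟨(t, S), ?_, Finset.forall_mem_union.2 ⟨hU, indepAt_iff.1 hindep⟩, hchain⟩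
  simp [ht₀, htT, hS]

open Classical in
lemma measureReal_chain_le {β B : ℝ} (hβ : 0 ≤ β) (hB : 0 ≤ B)
    (hstep : ∀ W : Finset (BipVertex n), W.card ≤ N →
      (T + 1) * ∑ S with OverlapsIn s q W S, (1 - p : ℝ) ^ (pairsIn S \ pairsIn W).card ≤ β)
    (hEnd : ∀ t₀ (W : Finset (BipVertex n)) (U : Finset (Fin (T + 1) × BipEdge n)),
      W.card ≤ N → SupportedIn U t₀ W →
      (bernoulliCube (Fin (T + 1) × BipEdge n) p).real
        {ω | (∀ u ∈ U, ω u = false) ∧ End t₀ W ω} ≤ (1 - p) ^ U.card * B)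
    (k : ℕ) (hW : W.card + k * (2 * s) ≤ N) (hU : SupportedIn U t₀ W) :
    (bernoulliCube (Fin (T + 1) × BipEdge n) p).real
        {ω | (∀ u ∈ U, ω u = false) ∧ Chain σ s q End k t₀ W ω} ≤
      (1 - p) ^ U.card * (β ^ k * B) := by
  have hp0 := unitInterval.one_minus_nonneg p
  induction k generalizing t₀ W U with
  | zero => simpa [Chain] using hEnd t₀ W U (by omega) hU
  | succ k ih =>
    have hterm (a) (ha : a ∈ Finset.Icc t₀ T ×ˢ ({S | OverlapsIn s q W S} : Finset _)) :
        (bernoulliCube (Fin (T + 1) × BipEdge n) p).real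
            {ω | (∀ u ∈ U ∪ pairCoords T σ a.1 a.2, ω u = false) ∧
              Chain σ s q End k a.1 (W ∪ a.2) ω} ≤
          (1 - p : ℝ) ^ (pairsIn a.2 \ pairsIn W).card * ((1 - p) ^ U.card * (β ^ k * B)) := by
      simp only [Finset.mem_product, Finset.mem_Icc, Finset.mem_filter_univ] at ha
      obtain ⟨⟨ht₀, -⟩, hS⟩ := ha
      have hcard := Finset.card_union_le W a.2
      rw [hS.1.card_eq] at hcard
      refine (ih (by linarith) (hU.union_pairCoords ht₀)).trans ?_
      rw [← mul_assoc ((1 - p : ℝ) ^ _) ((1 - p : ℝ) ^ _), ← pow_add,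
        Nat.add_comm (Finset.card _)]
      gcongr ?_ * _
      exact pow_le_pow_of_le_one hp0 (unitInterval.one_minus_le_one p) (card_union_pairCoords hU)
    calc _ ≤ _ := measureReal_chain_succ_le k
      _ ≤ _ := Finset.sum_le_sum hterm
      _ = ((Finset.Icc t₀ T).card * ∑ S with OverlapsIn s q W S,
            (1 - p : ℝ) ^ (pairsIn S \ pairsIn W).card) * ((1 - p) ^ U.card * (β ^ k * B)) := by
        simp only [Finset.sum_product, Finset.sum_const, nsmul_eq_mul, ← Finset.sum_mul]
      _ ≤ β * ((1 - p) ^ U.card * (β ^ k * B)) := by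
        refine mul_le_mul_of_nonneg_right (le_trans ?_ (hstep W (by omega))) (by positivity)
        refine mul_le_mul_of_nonneg_right ?_ (Finset.sum_nonneg fun _ _ => pow_nonneg hp0 _)
        rw [Nat.card_Icc]
        exact_mod_cast Nat.sub_le _ _
      _ = _ := by ring

open Classical in
lemma sum_overlapsIn_le (hqs : q ≤ s) {z w : ℝ} (hz : 0 ≤ z) (hw0 : 0 ≤ w) (hw1 : w ≤ 1)
    (hzw : (1 - p : ℝ) ^ (s - q) ≤ z * w) (hW : W.card ≤ N) :
    ∑ S with OverlapsIn s q W S, (1 - p : ℝ) ^ (pairsIn S \ pairsIn W).card ≤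
      w ^ q * (2 ^ N * (1 + z) ^ (2 * n)) := by
  have hp0 := unitInterval.one_minus_nonneg p
  have hp1 := unitInterval.one_minus_le_one p
  have hterm (S) (hS : S ∈ ({S | OverlapsIn s q W S} : Finset (Finset (BipVertex n)))) :
      (1 - p : ℝ) ^ (pairsIn S \ pairsIn W).card ≤ w ^ q * z ^ (S \ W).card := by
    have hov : OverlapsIn s q W S := by simpa using hS
    calc (1 - p : ℝ) ^ (pairsIn S \ pairsIn W).card
        ≤ ((1 - p) ^ (s - q)) ^ (S \ W).card := by
          rw [← pow_mul]
          exact pow_le_pow_of_le_one hp0 hp1 (hov.mul_card_sdiff_le hqs)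
      _ ≤ (z * w) ^ (S \ W).card := by gcongr
      _ = w ^ (S \ W).card * z ^ (S \ W).card := by rw [mul_pow, mul_comm]
      _ ≤ w ^ q * z ^ (S \ W).card := by
          gcongr ?_ * _
          exact pow_le_pow_of_le_one hw0 hw1 hov.2.2.2
  calc _ ≤ ∑ S with OverlapsIn s q W S, w ^ q * z ^ (S \ W).card := Finset.sum_le_sum hterm
    _ ≤ ∑ S : Finset (BipVertex n), w ^ q * z ^ (S \ W).card :=
        Finset.sum_le_sum_of_subset_of_nonneg (Finset.filter_subset _ _) fun _ _ _ => by positivity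
    _ = w ^ q * ∑ S : Finset (BipVertex n), z ^ (S \ W).card := by rw [Finset.mul_sum]
    _ ≤ w ^ q * (2 ^ W.card * (1 + z) ^ Fintype.card (BipVertex n)) := by
        gcongr
        exact sum_pow_card_sdiff_le hz W
    _ ≤ w ^ q * (2 ^ N * (1 + z) ^ (2 * n)) := by
        rw [Fintype.card_sum, Fintype.card_fin, ← two_mul]
        gcongr
        norm_num

lemma measureReal_lateIndep_le {m r : ℕ} (hσ : ∀ t₀ e, ∃ j, t₀ ≤ j ∧ j < t₀ + m ∧ σ j = e)
    (hW : W.card ≤ N) (hU : SupportedIn U t₀ W) :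
    (bernoulliCube (Fin (T + 1) × BipEdge n) p).real
        {ω | (∀ u ∈ U, ω u = false) ∧ LateIndep σ m r t₀ W ω} ≤
      (1 - p) ^ U.card * ((T + 1) * 2 ^ N * (1 - p) ^ (r * r)) := by
  classical
  have hp0 := unitInterval.one_minus_nonneg p
  set I := Finset.Icc (t₀ + m) T ×ˢ W.powerset.filter (IsBalanced r) with hI
  have hterm (a) (ha : a ∈ I) :
      (bernoulliCube (Fin (T + 1) × BipEdge n) p).real
        {ω | ∀ u ∈ U ∪ pairCoords T σ a.1 a.2, ω u = false} =
      (1 - p) ^ U.card * (1 - p) ^ (r * r) := by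
    simp only [hI, Finset.mem_product, Finset.mem_Icc, Finset.mem_filter] at ha
    rw [measureReal_bernoulliCube_forall_false,
      card_union_pairCoords_of_late hσ hU ha.1.1 ha.1.2, ha.2.2.card_pairsIn, pow_add]
  have hcard : (I.card : ℝ) ≤ (T + 1) * 2 ^ N := by
    have hpow : (W.powerset.filter (IsBalanced r)).card ≤ 2 ^ N := by
      refine (Finset.card_filter_le _ _).trans ?_
      rw [Finset.card_powerset]
      exact Nat.pow_le_pow_right two_pos hW
    rw [hI, Finset.card_product, Nat.card_Icc]
    exact_mod_cast Nat.mul_le_mul (Nat.sub_le _ _) hpow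
  calc _ ≤ (bernoulliCube (Fin (T + 1) × BipEdge n) p).real
          {ω | ∃ a ∈ I, ∀ u ∈ U ∪ pairCoords T σ a.1 a.2, ω u = false} := by
        refine measureReal_mono ?_
        rintro ω ⟨hfalse, t, ht, htT, S, hSW, hS, hindep⟩
        refine ⟨(t, S), ?_, Finset.forall_mem_union.2 ⟨hfalse, indepAt_iff.1 hindep⟩⟩
        simp [hI, ht, htT, hSW, hS]
    _ ≤ _ := measureReal_exists_mem_le _ _ _
    _ = I.card * ((1 - p) ^ U.card * (1 - p) ^ (r * r)) := by
        rw [Finset.sum_congr rfl hterm, Finset.sum_const, nsmul_eq_mul]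
    _ ≤ (T + 1) * 2 ^ N * ((1 - p) ^ U.card * (1 - p) ^ (r * r)) := by gcongr
    _ = _ := by ring

lemma measureReal_initialChain_le (hqs : q ≤ s) {z w : ℝ} (hz : 0 ≤ z) (hw0 : 0 ≤ w) (hw1 : w ≤ 1)
    (hzw : (1 - p : ℝ) ^ (s - q) ≤ z * w) {B : ℝ} (hB : 0 ≤ B)
    (hEnd : ∀ t₀ (W : Finset (BipVertex n)) (U : Finset (Fin (T + 1) × BipEdge n)),
      W.card ≤ N → SupportedIn U t₀ W →
      (bernoulliCube (Fin (T + 1) × BipEdge n) p).real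
        {ω | (∀ u ∈ U, ω u = false) ∧ End t₀ W ω} ≤ (1 - p) ^ U.card * B)
    (k : ℕ) (hk : (k + 1) * (2 * s) ≤ N) :
    (bernoulliCube (Fin (T + 1) × BipEdge n) p).real {ω | InitialChain σ s q End k ω} ≤
      n.choose s ^ 2 * (1 - p) ^ (s * s) *
        (((T + 1) * (w ^ q * (2 ^ N * (1 + z) ^ (2 * n)))) ^ k * B) := by
  classical
  set β : ℝ := (T + 1) * (w ^ q * (2 ^ N * (1 + z) ^ (2 * n)))
  set 𝒬 := (Finset.univ : Finset (Fin n)).powersetCard s with h𝒬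
  have hterm (a) (ha : a ∈ 𝒬 ×ˢ 𝒬) :
      (bernoulliCube (Fin (T + 1) × BipEdge n) p).real
        {ω | (∀ u ∈ ∅ ∪ pairCoords T σ 0 (a.1.disjSum a.2), ω u = false) ∧
          Chain σ s q End k 0 (∅ ∪ a.1.disjSum a.2) ω} ≤
      (1 - p) ^ (s * s) * (β ^ k * B) := by
    simp only [h𝒬, Finset.mem_product, Finset.mem_powersetCard_univ] at ha
    have hS : IsBalanced s (a.1.disjSum a.2) := by simpa [IsBalanced] using ha
    have hstart : SupportedIn (∅ : Finset (Fin (T + 1) × BipEdge n)) 0 ∅ := by simp [SupportedIn]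
    have hcard : (∅ ∪ pairCoords T σ 0 (a.1.disjSum a.2)).card = s * s := by
      rw [Finset.empty_union, pairCoords,
        Finset.card_image_of_injective _ (pathCoord_injective 0), hS.card_pairsIn]
    rw [← hcard]
    refine measureReal_chain_le (by positivity) hB (fun W hW => ?_) hEnd k ?_
      (hstart.union_pairCoords le_rfl)
    · exact mul_le_mul_of_nonneg_left (sum_overlapsIn_le hqs hz hw0 hw1 hzw hW) (by positivity)
    · rw [Finset.empty_union, hS.card_eq]
      linarith
  calc _ ≤ (bernoulliCube (Fin (T + 1) × BipEdge n) p).real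
          {ω | ∃ a ∈ 𝒬 ×ˢ 𝒬, (∀ u ∈ ∅ ∪ pairCoords T σ 0 (a.1.disjSum a.2), ω u = false) ∧
            Chain σ s q End k 0 (∅ ∪ a.1.disjSum a.2) ω} := by
        refine measureReal_mono ?_
        rintro ω ⟨S, hS, hindep, hchain⟩
        refine ⟨(S.toLeft, S.toRight), by simp [h𝒬, hS.1, hS.2], ?_⟩
        simpa only [Finset.empty_union, Finset.toLeft_disjSum_toRight] using
          ⟨indepAt_iff.1 hindep, hchain⟩
    _ ≤ _ := measureReal_exists_mem_le _ _ _
    _ ≤ _ := Finset.sum_le_sum hterm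
    _ = _ := by
        rw [Finset.sum_const, nsmul_eq_mul, Finset.card_product, h𝒬, Finset.card_powersetCard,
          Finset.card_univ, Fintype.card_fin]
        push_cast
        ring

end FirstMoment

/-! ### Stable sequences of independent sets contain chains -/

/-- `S` has at least `s` vertices on each side. -/
def IsLarge {n : ℕ} (s : ℕ) (S : Finset (BipVertex n)) : Prop :=
  s ≤ S.toLeft.card ∧ s ≤ S.toRight.card

section Stable

variable {n T : ℕ} {σ : ℕ → BipEdge n} {ω : Fin (T + 1) × BipEdge n → Bool} {s q : ℕ}

lemma IndepAt.mono {t : ℕ} {V S : Finset (BipVertex n)} (hV : IndepAt σ ω t V) (hS : S ⊆ V) :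
    IndepAt σ ω t S :=
  Set.Pairwise.mono (Finset.coe_subset.2 hS) hV

lemma exists_subset_card_eq_card_sdiff_eq {α : Type*} [DecidableEq α] {V : Finset α}
    (W : Finset α) (hs : s ≤ V.card) :
    ∃ S ⊆ V, S.card = s ∧ (S \ W).card = s - (V ∩ W).card := by
  rcases le_or_gt s (V ∩ W).card with h | h
  · obtain ⟨S, hS, hcard⟩ := Finset.exists_subset_card_eq h
    refine ⟨S, hS.trans Finset.inter_subset_left, hcard, ?_⟩
    rw [Finset.sdiff_eq_empty_iff_subset.2 (hS.trans Finset.inter_subset_right), Finset.card_empty,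
      Nat.sub_eq_zero_of_le h]
  · obtain ⟨S, hVWS, hSV, hcard⟩ := Finset.exists_subsuperset_card_eq
      (Finset.inter_subset_left (s₁ := V) (s₂ := W)) h.le hs
    have hinter : S ∩ W = V ∩ W :=
      (Finset.inter_subset_inter_right hSV).antisymm
        (Finset.subset_inter hVWS Finset.inter_subset_right)
    exact ⟨S, hSV, hcard, by rw [Finset.card_sdiff, Finset.inter_comm, hinter, hcard]⟩

lemma IsLarge.exists_isBalanced_subset {V : Finset (BipVertex n)} (hV : IsLarge s V)
    (W : Finset (BipVertex n)) :
    ∃ S ⊆ V, IsBalanced s S ∧ (S \ W).toLeft.card = s - (V ∩ W).toLeft.card ∧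
      (S \ W).toRight.card = s - (V ∩ W).toRight.card := by
  obtain ⟨L, hLV, hL, hLW⟩ := exists_subset_card_eq_card_sdiff_eq W.toLeft hV.1
  obtain ⟨R, hRV, hR, hRW⟩ := exists_subset_card_eq_card_sdiff_eq W.toRight hV.2
  refine ⟨L.disjSum R, Finset.disjSum_subset.2 ⟨hLV, hRV⟩, by simp [IsBalanced, hL, hR], ?_, ?_⟩
  · rw [Finset.toLeft_sdiff, Finset.toLeft_disjSum, Finset.toLeft_inter, hLW]
  · rw [Finset.toRight_sdiff, Finset.toRight_disjSum, Finset.toRight_inter, hRW]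

lemma exists_overlapsIn_of_isLarge {V V' W : Finset (BipVertex n)} (hV : IsLarge (s - q) (V ∩ W))
    (hjump : (V \ V').card ≤ q) (hV' : IsLarge s V') (hdrop : ¬ IsLarge (s - q) (V' ∩ W)) :
    ∃ S ⊆ V', OverlapsIn s q W S := by
  obtain ⟨S, hSV', hS, hSL, hSR⟩ := hV'.exists_isBalanced_subset W
  have hsub : V ∩ W ⊆ V' ∩ W ∪ V \ V' := by
    intro v hv
    simp only [Finset.mem_inter, Finset.mem_union, Finset.mem_sdiff] at hv ⊢
    tauto
  have hL := Finset.card_le_card (Finset.toLeft_subset_toLeft hsub)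
  have hR := Finset.card_le_card (Finset.toRight_subset_toRight hsub)
  rw [Finset.toLeft_union] at hL
  rw [Finset.toRight_union] at hR
  have hLu := Finset.card_union_le (V' ∩ W).toLeft (V \ V').toLeft
  have hRu := Finset.card_union_le (V' ∩ W).toRight (V \ V').toRight
  have hLj := (Finset.card_toLeft_le (u := V \ V')).trans hjump
  have hRj := (Finset.card_toRight_le (u := V \ V')).trans hjump
  have hcard := Finset.card_toLeft_add_card_toRight (u := S \ W)
  simp only [IsLarge] at hV hdrop
  exact ⟨S, hSV', hS, by omega, by omega, by omega⟩

variable {V : ℕ → Finset (BipVertex n)} {m t₀ : ℕ} {W : Finset (BipVertex n)}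

lemma exists_overlapsIn_of_not_lateIndep (hindep : ∀ t ≤ T, IndepAt σ ω t (V t))
    (hlarge : ∀ t ≤ T, IsLarge s (V t)) (hjump : ∀ t < T, (V t \ V (t + 1)).card ≤ q)
    (hT : t₀ + m ≤ T) (hstart : IsLarge s (V t₀ ∩ W)) (hlate : ¬ LateIndep σ m (s - q) t₀ W ω) :
    ∃ t, t₀ ≤ t ∧ t ≤ t₀ + m ∧ ∃ S ⊆ V t, OverlapsIn s q W S := by
  have hdrop : ∃ i < m, IsLarge (s - q) (V (t₀ + i) ∩ W) ∧
      ¬ IsLarge (s - q) (V (t₀ + i + 1) ∩ W) := by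
    by_contra! hkeep
    have hall : ∀ i ≤ m, IsLarge (s - q) (V (t₀ + i) ∩ W) := by
      intro i hi
      induction i with
      | zero => exact ⟨(Nat.sub_le _ _).trans hstart.1, (Nat.sub_le _ _).trans hstart.2⟩
      | succ i ih => exact hkeep i hi (ih (Nat.le_of_succ_le hi))
    obtain ⟨S, hS, hbal, -⟩ := (hall m le_rfl).exists_isBalanced_subset ∅
    exact hlate ⟨t₀ + m, le_rfl, hT, S, hS.trans Finset.inter_subset_right, hbal,
      (hindep _ hT).mono (hS.trans Finset.inter_subset_left)⟩
  obtain ⟨i, him, hprev, hnext⟩ := hdrop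
  exact ⟨t₀ + i + 1, by omega, by omega, exists_overlapsIn_of_isLarge hprev
    (hjump _ (by omega)) (hlarge _ (by omega)) hnext⟩

lemma chain_or_exists_chain_lateIndep (hindep : ∀ t ≤ T, IndepAt σ ω t (V t))
    (hlarge : ∀ t ≤ T, IsLarge s (V t)) (hjump : ∀ t < T, (V t \ V (t + 1)).card ≤ q) (k : ℕ)
    (hT : t₀ + k * m ≤ T) (hstart : IsLarge s (V t₀ ∩ W)) :
    Chain σ s q (fun _ _ _ => True) k t₀ W ω ∨
      ∃ j < k, Chain σ s q (LateIndep σ m (s - q)) j t₀ W ω := by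
  induction k generalizing t₀ W with
  | zero => exact Or.inl trivial
  | succ k ih =>
    rw [Nat.succ_mul] at hT
    by_cases hlate : LateIndep σ m (s - q) t₀ W ω
    · exact Or.inr ⟨0, Nat.succ_pos k, hlate⟩
    obtain ⟨t, ht₀, htm, S, hSV, hS⟩ := exists_overlapsIn_of_not_lateIndep hindep hlarge hjump
      (by omega) hstart hlate
    have htT : t ≤ T := by omega
    have hsub : S ⊆ V t ∩ (W ∪ S) := Finset.subset_inter hSV Finset.subset_union_right
    have hstart' : IsLarge s (V t ∩ (W ∪ S)) :=
      ⟨hS.1.1.symm.le.trans (Finset.card_le_card (Finset.toLeft_subset_toLeft hsub)),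
        hS.1.2.symm.le.trans (Finset.card_le_card (Finset.toRight_subset_toRight hsub))⟩
    have hSindep := (hindep t htT).mono hSV
    rcases ih (t₀ := t) (W := W ∪ S) (by omega) hstart' with h | ⟨j, hj, h⟩
    · exact Or.inl ⟨t, ht₀, htT, S, hS, hSindep, h⟩
    · exact Or.inr ⟨j + 1, by omega, t, ht₀, htT, S, hS, hSindep, h⟩

end Stable

/-! ### The obstruction for stable maps -/

/-- The squared Euclidean distance between the values of `f` at the endpoints of the edge of the
cube through `x` in direction `e`. -/
def jumpSq {ι V : Type*} [DecidableEq ι] [Fintype V] (f : (ι → Bool) → V → ℝ) (e : ι)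
    (x : ι → Bool) : ℝ :=
  ∑ v, cubeDeriv e (fun y => f y v) x ^ 2

/-- The output of `f` on the graph `A` is rounded to a set with at least `s` vertices on each
side. -/
def RoundsTo {n : ℕ} (η : ℝ) (s : ℕ) (f : (BipEdge n → Bool) → BipVertex n → ℝ)
    (A : BipEdge n → Bool) : Prop :=
  IsLarge s (roundedSet η A (f A))

section Jump

variable {ι V : Type*} [DecidableEq ι] [Fintype V] {f : (ι → Bool) → V → ℝ}

lemma jumpSq_update (e : ι) (x : ι → Bool) (b : Bool) :
    jumpSq f e (Function.update x e b) = jumpSq f e x := by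
  simp [jumpSq, cubeDeriv]

lemma sum_sq_sub_update_le_jumpSq (e : ι) (x : ι → Bool) (b : Bool) :
    ∑ v, (f x v - f (Function.update x e b) v) ^ 2 ≤ jumpSq f e x := by
  refine Finset.sum_le_sum fun v _ => ?_
  have hx := Function.update_eq_self e x
  simp only [cubeDeriv]
  cases hxe : x e <;> rw [hxe] at hx <;> cases b <;> rw [hx]
  · simpa using sq_nonneg _
  · rw [sub_sq_comm]
  · simpa using sq_nonneg _

-- Markov's inequality for each direction, summed by the bound on the total influence.
lemma sum_measureReal_lt_jumpSq_le [Fintype ι] {p : unitInterval} (h0 : 0 < (p : ℝ))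
    (h1 : (p : ℝ) < 1) {D : ℕ} (hf : ∀ v, (fun x => f x v) ∈ lowDegree p D) {c : ℝ} (hc : 0 < c) :
    ∑ e, (bernoulliCube ι p).real {x | c < jumpSq f e x} ≤
      D * (∫ x, ∑ v, f x v ^ 2 ∂bernoulliCube ι p) / (c * (p * (1 - p))) := by
  have hvar : 0 < (p : ℝ) * (1 - p) := mul_pos h0 (sub_pos.2 h1)
  have hmarkov (e : ι) : c * (bernoulliCube ι p).real {x | c < jumpSq f e x} ≤
      ∑ v, ∫ x, cubeDeriv e (fun y => f y v) x ^ 2 ∂bernoulliCube ι p := by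
    rw [← integral_finsetSum _ fun _ _ => .of_finite]
    refine le_trans ?_ (mul_meas_ge_le_integral_of_nonneg
      (.of_forall fun x => Finset.sum_nonneg fun v _ => sq_nonneg _) .of_finite c)
    exact mul_le_mul_of_nonneg_left (measureReal_mono fun x (hx : c < jumpSq f e x) => hx.le) hc.le
  rw [le_div_iff₀ (mul_pos hc hvar)]
  calc _ = p * (1 - p) * ∑ e, c * (bernoulliCube ι p).real {x | c < jumpSq f e x} := by
        rw [← Finset.mul_sum]
        ring
    _ ≤ p * (1 - p) * ∑ e, ∑ v, ∫ x, cubeDeriv e (fun y => f y v) x ^ 2 ∂bernoulliCube ι p :=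
        mul_le_mul_of_nonneg_left (Finset.sum_le_sum fun e _ => hmarkov e) hvar.le
    _ = ∑ v, ∑ e, p * (1 - p) * ∫ x, cubeDeriv e (fun y => f y v) x ^ 2 ∂bernoulliCube ι p := by
        rw [Finset.sum_comm, Finset.mul_sum]
        simp only [Finset.mul_sum]
    _ ≤ ∑ v, D * ∫ x, f x v ^ 2 ∂bernoulliCube ι p :=
        Finset.sum_le_sum fun v _ => total_influence_le (hf v)
    _ = D * ∫ x, ∑ v, f x v ^ 2 ∂bernoulliCube ι p := by
        rw [integral_finsetSum _ fun _ _ => .of_finite, Finset.mul_sum]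

lemma AvoidsBad.sum_sq_sub_le {T : ℕ} {σ : ℕ → ι} {ω : Fin (T + 1) × ι → Bool} {c : ℝ}
    (hω : AvoidsBad σ (fun e x => c < jumpSq f e x) ω T) (hc : 0 ≤ c) {t : ℕ} (ht : t < T) :
    ∑ v, (f (pathState σ ω t) v - f (pathState σ ω (t + 1)) v) ^ 2 ≤ c := by
  by_cases hbad : c < jumpSq f (σ t) (pathState σ ω t)
  · simpa [hω t ht hbad] using hc
  · rw [pathState_succ]
    exact (sum_sq_sub_update_le_jumpSq _ _ _).trans (not_lt.1 hbad)

end Jump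

section Rounding

variable {n : ℕ} {η : ℝ} {A B : BipEdge n → Bool} {x y : BipVertex n → ℝ}

lemma roundedSet_eq_of_isLarge {s : ℕ} (hs : 0 < s) (h : IsLarge s (roundedSet η A x)) :
    (((roundI x \ roundITilde A x).card + (roundJ x).card : ℕ) : ℝ) ≤ η * n ∧
      roundedSet η A x = roundITilde A x := by
  classical
  unfold roundedSet at h ⊢
  split_ifs at h ⊢ with hfew
  · exact ⟨hfew, rfl⟩
  · exact absurd (h.1.trans Finset.card_toLeft_le) (by simpa using hs.ne')

lemma isIndepSet_roundITilde : (bipGraph A).IsIndepSet (roundITilde A x) := by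
  classical
  intro u hu v hv _
  simp only [roundITilde, Finset.coe_filter, Set.mem_ofPred_eq] at hu hv
  exact hu.2 v hv.1

-- A coordinate that leaves the rounded set either drops by at least `1/2` or is one of the few
-- coordinates that the rounding of `y` discards.
lemma card_roundITilde_sdiff_le
    (hy : (((roundI y \ roundITilde B y).card + (roundJ y).card : ℕ) : ℝ) ≤ η * n) :
    ((roundITilde A x \ roundITilde B y).card : ℝ) ≤ 4 * ∑ v, (x v - y v) ^ 2 + η * n := by
  classical
  set S := Finset.univ.filter fun v => 1 ≤ x v ∧ y v ≤ 1 / 2 with hS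
  have hsub : roundITilde A x \ roundITilde B y ⊆
      S ∪ ((roundI y \ roundITilde B y) ∪ roundJ y) := by
    intro v hv
    obtain ⟨hvA, hvB⟩ := Finset.mem_sdiff.1 hv
    have hx : 1 ≤ x v := (Finset.mem_filter.1 (Finset.mem_filter.1 hvA).1).2
    simp only [Finset.mem_union, hS, Finset.mem_filter_univ, Finset.mem_sdiff, hvB, roundJ, roundI]
    grind
  have hScard : (S.card : ℝ) ≤ 4 * ∑ v, (x v - y v) ^ 2 := by
    have hdrop : ∀ v ∈ S, 1 / 4 ≤ (x v - y v) ^ 2 := by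
      intro v hv
      obtain ⟨hx, hy⟩ := (Finset.mem_filter.1 hv).2
      nlinarith
    have hsum := (Finset.card_nsmul_le_sum S _ _ hdrop).trans
      (Finset.sum_le_univ_sum_of_nonneg fun v => sq_nonneg (x v - y v))
    rw [nsmul_eq_mul] at hsum
    linarith
  have hcard := (Finset.card_le_card hsub).trans ((Finset.card_union_le _ _).trans
    (Nat.add_le_add_left (Finset.card_union_le _ _) _))
  calc ((roundITilde A x \ roundITilde B y).card : ℝ)
      ≤ S.card + ((roundI y \ roundITilde B y).card + (roundJ y).card : ℕ) := by
        exact_mod_cast hcard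
    _ ≤ _ := add_le_add hScard hy

end Rounding

section Obstruction

variable {n T K s q N : ℕ} {σ : ℕ → BipEdge n} {p : unitInterval} {η c z w β : ℝ}
  {f : (BipEdge n → Bool) → BipVertex n → ℝ}

lemma AvoidsBad.exists_initialChain {m : ℕ} (hT : K * m ≤ T) (hs : 0 < s)
    (hq : 4 * c + η * n ≤ q) (hc : 0 ≤ c) {ω : Fin (T + 1) × BipEdge n → Bool}
    (hω : AvoidsBad σ (fun e x => c < jumpSq f e x) ω T)
    (hround : ∀ t ≤ T, RoundsTo η s f (pathState σ ω t)) :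
    InitialChain σ s q (fun _ _ _ => True) K ω ∨
      ∃ j ∈ Finset.range K, InitialChain σ s q (LateIndep σ m (s - q)) j ω := by
  set V : ℕ → Finset (BipVertex n) := fun t => roundITilde (pathState σ ω t) (f (pathState σ ω t))
  have hVeq (t) (ht : t ≤ T) := roundedSet_eq_of_isLarge hs (hround t ht)
  have hlarge (t) (ht : t ≤ T) : IsLarge s (V t) := by
    have h := hround t ht
    rwa [RoundsTo, (hVeq t ht).2] at h
  have hindep (t) (_ : t ≤ T) : IndepAt σ ω t (V t) := isIndepSet_roundITilde
  have hjump (t) (ht : t < T) : (V t \ V (t + 1)).card ≤ q := by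
    have hcard := card_roundITilde_sdiff_le (A := pathState σ ω t) (x := f (pathState σ ω t))
      (hVeq (t + 1) ht).1
    have hsq := hω.sum_sq_sub_le hc ht
    have hle : ((V t \ V (t + 1)).card : ℝ) ≤ q := hcard.trans (by linarith)
    exact_mod_cast hle
  obtain ⟨S, hSV, hS, -⟩ := (hlarge 0 T.zero_le).exists_isBalanced_subset ∅
  have hstart : IsLarge s (V 0 ∩ S) := by
    rw [Finset.inter_eq_right.2 hSV]
    exact ⟨hS.1.ge, hS.2.ge⟩
  have hSindep := (hindep 0 T.zero_le).mono hSV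
  rcases chain_or_exists_chain_lateIndep (m := m) hindep hlarge hjump K (by omega) hstart with
    h | ⟨j, hj, h⟩
  · exact Or.inl ⟨S, hS, hSindep, h⟩
  · exact Or.inr ⟨j, Finset.mem_range.2 hj, S, hS, hSindep, h⟩

lemma measureReal_exists_pathState_le (P : (BipEdge n → Bool) → Prop) :
    (bernoulliCube (Fin (T + 1) × BipEdge n) p).real
        {ω | ∃ t ∈ Finset.range (T + 1), P (pathState σ ω t)} ≤
      (T + 1) * (bernoulliCube (BipEdge n) p).real {A | P A} := by
  refine (measureReal_exists_mem_le _ _ _).trans (le_of_eq ?_)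
  have hlaw (t : ℕ) :=
    (measurePreserving_pathState (T := T) (σ := σ) (p := p) t).measureReal_preimage
      (s := {A | P A}) MeasurableSet.of_discrete.nullMeasurableSet
  simp only [Set.preimage_ofPred_eq] at hlaw
  simp [hlaw]

lemma measureReal_initialChain_true_le (hqs : q ≤ s) (hz : 0 ≤ z) (hw0 : 0 ≤ w) (hw1 : w ≤ 1)
    (hzw : (1 - p : ℝ) ^ (s - q) ≤ z * w) (hN : (K + 1) * (2 * s) ≤ N)
    (hβ : (T + 1) * (w ^ q * (2 ^ N * (1 + z) ^ (2 * n))) ≤ β) :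
    (bernoulliCube (Fin (T + 1) × BipEdge n) p).real
        {ω | InitialChain σ s q (fun _ _ _ => True) K ω} ≤
      n.choose s ^ 2 * (1 - p) ^ (s * s) * β ^ K := by
  have hp0 := unitInterval.one_minus_nonneg p
  refine (measureReal_initialChain_le hqs hz hw0 hw1 hzw zero_le_one (fun t₀ W U _ _ => ?_) K
    hN).trans ?_
  · simpa using (measureReal_bernoulliCube_forall_false U).le
  · rw [mul_one]
    gcongr

lemma measureReal_exists_initialChain_lateIndep_le {m : ℕ}
    (hσ : ∀ t₀ e, ∃ j, t₀ ≤ j ∧ j < t₀ + m ∧ σ j = e) (hqs : q ≤ s) (hz : 0 ≤ z) (hw0 : 0 ≤ w)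
    (hw1 : w ≤ 1) (hzw : (1 - p : ℝ) ^ (s - q) ≤ z * w) (hN : (K + 1) * (2 * s) ≤ N)
    (hβ : (T + 1) * (w ^ q * (2 ^ N * (1 + z) ^ (2 * n))) ≤ 1) (r : ℕ) :
    (bernoulliCube (Fin (T + 1) × BipEdge n) p).real
        {ω | ∃ j ∈ Finset.range K, InitialChain σ s q (LateIndep σ m r) j ω} ≤
      n.choose s ^ 2 * (1 - p) ^ (s * s) * (K * ((T + 1) * 2 ^ N * (1 - p) ^ (r * r))) := by
  have hp0 := unitInterval.one_minus_nonneg p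
  have hterm (j) (hj : j ∈ Finset.range K) :
      (bernoulliCube (Fin (T + 1) × BipEdge n) p).real
        {ω | InitialChain σ s q (LateIndep σ m r) j ω} ≤
      n.choose s ^ 2 * (1 - p) ^ (s * s) * ((T + 1) * 2 ^ N * (1 - p) ^ (r * r)) := by
    have hj' : (j + 1) * (2 * s) ≤ N :=
      (Nat.mul_le_mul_right _ (by have := Finset.mem_range.1 hj; omega)).trans hN
    refine (measureReal_initialChain_le hqs hz hw0 hw1 hzw (by positivity)
      (fun t₀ W U hW hU => measureReal_lateIndep_le hσ hW hU) j hj').trans ?_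
    exact mul_le_mul_of_nonneg_left
      (mul_le_of_le_one_left (by positivity) (pow_le_one₀ (by positivity) hβ)) (by positivity)
  refine (measureReal_exists_mem_le _ _ _).trans ((Finset.sum_le_sum hterm).trans (le_of_eq ?_))
  rw [Finset.sum_const, Finset.card_range, nsmul_eq_mul]
  ring

lemma exp_le_measureReal_avoidsBad_jumpSq (hn : 0 < n) (h0 : 0 < (p : ℝ)) (h1 : (p : ℝ) < 1)
    {D : ℕ} (hf : ∀ v, (fun A => f A v) ∈ lowDegree p D) (hc : 0 < c) (hT : T = K * n ^ 2) :
    ∃ σ : ℕ → BipEdge n, (∀ t₀ e, ∃ j, t₀ ≤ j ∧ j < t₀ + n ^ 2 ∧ σ j = e) ∧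
      Real.exp (-(Real.binEntropy p *
        (K * (D * (∫ A, ∑ v, f A v ^ 2 ∂bernoulliCube (BipEdge n) p) / (c * (p * (1 - p))))))) ≤
      (bernoulliCube (Fin (T + 1) × BipEdge n) p).real
        {ω | AvoidsBad σ (fun e x => c < jumpSq f e x) ω T} := by
  have : Nonempty (BipEdge n) := ⟨(⟨0, hn⟩, ⟨0, hn⟩)⟩
  have hcard : Fintype.card (BipEdge n) = n ^ 2 := by simp [sq]
  refine ⟨sweep (BipEdge n), by simpa only [hcard] using exists_sweep_eq (E := BipEdge n), ?_⟩
  refine le_trans (Real.exp_le_exp.2 (neg_le_neg (mul_le_mul_of_nonneg_left ?_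
    (Real.binEntropy_nonneg p.2.1 p.2.2))))
    (exp_le_measureReal_avoidsBad (T := T) h0 h1 fun e x b => by rw [jumpSq_update])
  rw [hT, ← hcard,
    sum_range_sweep (fun e => (bernoulliCube (BipEdge n) p).real {x | c < jumpSq f e x}) K]
  exact mul_le_mul_of_nonneg_left (sum_measureReal_lt_jumpSq_le h0 h1 hf hc) K.cast_nonneg

lemma measureReal_avoidsBad_jumpSq_le {m : ℕ}
    (hσ : ∀ t₀ e, ∃ j, t₀ ≤ j ∧ j < t₀ + m ∧ σ j = e) (hT : K * m ≤ T) (hs : 0 < s)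
    (hq : 4 * c + η * n ≤ q) (hc : 0 ≤ c) (hqs : q ≤ s) (hz : 0 ≤ z) (hw0 : 0 ≤ w) (hw1 : w ≤ 1)
    (hzw : (1 - p : ℝ) ^ (s - q) ≤ z * w) (hN : (K + 1) * (2 * s) ≤ N)
    (hβ : (T + 1) * (w ^ q * (2 ^ N * (1 + z) ^ (2 * n))) ≤ β) (hβ1 : β ≤ 1) :
    (bernoulliCube (Fin (T + 1) × BipEdge n) p).real
        {ω | AvoidsBad σ (fun e x => c < jumpSq f e x) ω T} ≤
      (T + 1) * (bernoulliCube (BipEdge n) p).real {A | ¬ RoundsTo η s f A} +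
        n.choose s ^ 2 * (1 - p) ^ (s * s) *
          (β ^ K + K * ((T + 1) * 2 ^ N * (1 - p) ^ ((s - q) * (s - q)))) := by
  have hcover : {ω : Fin (T + 1) × BipEdge n → Bool |
        AvoidsBad σ (fun e x => c < jumpSq f e x) ω T} ⊆
      {ω | ∃ t ∈ Finset.range (T + 1), ¬ RoundsTo η s f (pathState σ ω t)} ∪
        ({ω | InitialChain σ s q (fun _ _ _ => True) K ω} ∪
          {ω | ∃ j ∈ Finset.range K, InitialChain σ s q (LateIndep σ m (s - q)) j ω}) := by
    intro ω hω
    by_cases hround : ∀ t ≤ T, RoundsTo η s f (pathState σ ω t)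
    · exact Or.inr (AvoidsBad.exists_initialChain hT hs hq hc hω hround)
    · push Not at hround
      obtain ⟨t, ht, h⟩ := hround
      exact Or.inl ⟨t, Finset.mem_range_succ_iff.2 ht, h⟩
  have hround := measureReal_exists_pathState_le (T := T) (σ := σ) (p := p)
    fun A => ¬ RoundsTo η s f A
  have hchain := measureReal_initialChain_true_le (σ := σ) hqs hz hw0 hw1 hzw hN hβ
  have hlate := measureReal_exists_initialChain_lateIndep_le hσ hqs hz hw0 hw1 hzw hN
    (hβ.trans hβ1) (s - q)
  refine (measureReal_mono hcover).trans ((measureReal_union_le _ _).trans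
    (add_le_add hround ((measureReal_union_le _ _).trans ?_)))
  rw [mul_add]
  exact add_le_add hchain hlate

end Obstruction

/-! ### Estimates for the first moment -/

lemma one_sub_pow_le_exp {p y : ℝ} (h1 : p ≤ 1) (k : ℕ) (hy : y ≤ p * k) :
    (1 - p) ^ k ≤ Real.exp (-y) := by
  calc (1 - p) ^ k ≤ Real.exp (-p) ^ k :=
        pow_le_pow_left₀ (sub_nonneg.2 h1) (Real.one_sub_le_exp_neg p) _
    _ = Real.exp (-(p * k)) := by rw [← Real.exp_nat_mul]; ring_nf
    _ ≤ Real.exp (-y) := Real.exp_le_exp.2 (neg_le_neg hy)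

lemma one_add_pow_le_exp {z : ℝ} (hz : 0 ≤ z) (k : ℕ) : (1 + z) ^ k ≤ Real.exp (z * k) := by
  calc (1 + z) ^ k ≤ Real.exp z ^ k :=
        pow_le_pow_left₀ (by positivity) ((add_comm 1 z).trans_le (Real.add_one_le_exp z)) _
    _ = Real.exp (z * k) := by rw [← Real.exp_nat_mul, mul_comm]

lemma binEntropy_le_mul {p a : ℝ} (h0 : 0 < p) (h1 : p ≤ 1 / 2) (hp : -Real.log p ≤ a)
    (ha : 1 ≤ a) : Real.binEntropy p ≤ 4 * a * (p * (1 - p)) := by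
  have hsub : 0 < 1 - p := by linarith
  have hleft : p * -Real.log p ≤ p * a := mul_le_mul_of_nonneg_left hp h0.le
  have hright : (1 - p) * -Real.log (1 - p) ≤ p := by
    have hlog := mul_le_mul_of_nonneg_left (Real.one_sub_inv_le_log_of_pos hsub) hsub.le
    rw [mul_sub, mul_inv_cancel₀ hsub.ne'] at hlog
    linarith
  have hvar : p ≤ 2 * (p * (1 - p)) := by nlinarith
  rw [Real.binEntropy, Real.log_inv, Real.log_inv]
  nlinarith [mul_pos h0 hsub]

/-- The scale `(log d / d) n`, around which the sides of the largest balanced independent sets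
concentrate. -/
noncomputable def sideScale (d : ℝ) (n : ℕ) : ℝ := Real.log d / d * n

/-- The relations between the sizes under which the first moment of the chains is small: the
independent sets have `s` vertices on each side, they may lose `q` vertices in one step, and the
path makes `K` sweeps. -/
structure SizeBounds (ε d : ℝ) (n K s q : ℕ) : Prop where
  ε_pos : 0 < ε
  ε_le_one : ε ≤ 1
  d_pos : 0 < d
  le_log : 6 * ((K : ℝ) + 1) + 4 ≤ ε ^ 2 / 32 * Real.log d
  le_K : 48 ≤ K * ε ^ 2
  le_scale : 8 ≤ ε * sideScale d n
  log_le_scale : Real.log d ≤ sideScale d n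
  time_le : K * (n : ℝ) ^ 2 + 1 ≤ Real.exp (sideScale d n)
  le_n : 2 * d ≤ n
  le_s : (1 + ε) * sideScale d n ≤ s
  s_le : s ≤ (1 + ε) * sideScale d n + 1
  le_q : ε / 8 * sideScale d n ≤ q
  q_le : q ≤ ε / 8 * sideScale d n + 1

namespace SizeBounds

variable {ε d : ℝ} {n K s q : ℕ}

lemma eight_le_scale (h : SizeBounds ε d n K s q) : 8 ≤ sideScale d n := by
  nlinarith [h.le_scale, h.ε_le_one, h.ε_pos]

lemma ten_le_log (h : SizeBounds ε d n K s q) : 10 ≤ Real.log d := by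
  have hε : ε ^ 2 / 32 ≤ 1 := by nlinarith [h.ε_pos, h.ε_le_one]
  have hε0 : 0 < ε ^ 2 / 32 := div_pos (pow_pos h.ε_pos 2) (by norm_num)
  nlinarith [h.le_log, K.cast_nonneg (α := ℝ)]

lemma n_pos (h : SizeBounds ε d n K s q) : (0 : ℝ) < n := by linarith [h.le_n, h.d_pos]

lemma prob_pos (h : SizeBounds ε d n K s q) : 0 < d / n := div_pos h.d_pos h.n_pos

lemma prob_le_half (h : SizeBounds ε d n K s q) : d / n ≤ 1 / 2 := by
  rw [div_le_div_iff₀ h.n_pos two_pos]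
  linarith [h.le_n]

lemma prob_mul_scale (h : SizeBounds ε d n K s q) : d / n * sideScale d n = Real.log d := by
  have hn := h.n_pos
  have hd := h.d_pos
  unfold sideScale
  field_simp

lemma inv_mul_le_scale (h : SizeBounds ε d n K s q) : d⁻¹ * n ≤ sideScale d n := by
  have hn : 0 ≤ d⁻¹ * (n : ℝ) := mul_nonneg (inv_nonneg.2 h.d_pos.le) h.n_pos.le
  rw [sideScale, div_mul_eq_mul_div, mul_div_assoc, div_eq_inv_mul]
  nlinarith [h.ten_le_log]

lemma inv_eq_exp (h : SizeBounds ε d n K s q) : d⁻¹ = Real.exp (-Real.log d) := by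
  rw [Real.exp_neg, Real.exp_log h.d_pos]

lemma q_le_quarter (h : SizeBounds ε d n K s q) : (q : ℝ) ≤ ε / 4 * sideScale d n := by
  linarith [h.q_le, h.le_scale]

lemma q_le_s (h : SizeBounds ε d n K s q) : q ≤ s := by
  have hle : (q : ℝ) ≤ s := by
    nlinarith [h.q_le_quarter, h.le_s, h.eight_le_scale, h.ε_pos]
  exact_mod_cast hle

lemma s_pos (h : SizeBounds ε d n K s q) : 0 < s := by
  have hpos : (0 : ℝ) < s := by nlinarith [h.le_s, h.eight_le_scale, h.ε_pos]
  exact_mod_cast hpos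

lemma s_le_three_mul (h : SizeBounds ε d n K s q) : (s : ℝ) ≤ 3 * sideScale d n := by
  nlinarith [h.s_le, h.eight_le_scale, h.ε_le_one]

lemma le_sub (h : SizeBounds ε d n K s q) :
    (1 + 3 * ε / 4) * sideScale d n ≤ (s - q : ℕ) := by
  rw [Nat.cast_sub h.q_le_s]
  linarith [h.q_le_quarter, h.le_s]

lemma mul_log_le (h : SizeBounds ε d n K s q) {a x : ℝ} (hx : a * sideScale d n ≤ x) :
    a * Real.log d ≤ d / n * x := by
  have hmul := mul_le_mul_of_nonneg_left hx h.prob_pos.le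
  rwa [mul_left_comm, h.prob_mul_scale] at hmul

lemma one_sub_pow_le (h : SizeBounds ε d n K s q) :
    (1 - d / n) ^ (s - q) ≤ d⁻¹ * Real.exp (-(3 * ε / 4 * Real.log d)) := by
  refine (one_sub_pow_le_exp (by linarith [h.prob_le_half]) _ (h.mul_log_le h.le_sub)).trans
    (le_of_eq ?_)
  rw [h.inv_eq_exp, ← Real.exp_add]
  ring_nf

lemma two_pow_le (h : SizeBounds ε d n K s q) :
    (2 : ℝ) ^ ((K + 1) * (2 * s)) ≤ Real.exp (6 * (K + 1) * sideScale d n) := by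
  have htwo := one_add_pow_le_exp (zero_le_one' ℝ) ((K + 1) * (2 * s))
  rw [one_add_one_eq_two] at htwo
  refine htwo.trans (Real.exp_le_exp.2 ?_)
  push_cast
  nlinarith [h.s_le_three_mul, K.cast_nonneg (α := ℝ)]

lemma one_step_le (h : SizeBounds ε d n K s q) :
    (K * (n : ℝ) ^ 2 + 1) * (Real.exp (-(3 * ε / 4 * Real.log d)) ^ q *
        (2 ^ ((K + 1) * (2 * s)) * (1 + d⁻¹) ^ (2 * n))) ≤
      Real.exp (-(ε ^ 2 / 16 * Real.log d * sideScale d n)) := by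
  have hd := h.d_pos
  have hΦ := h.eight_le_scale
  have hl := h.ten_le_log
  have hε := h.ε_pos
  have hpow : Real.exp (-(3 * ε / 4 * Real.log d)) ^ q ≤
      Real.exp (-(3 * ε ^ 2 / 32 * Real.log d * sideScale d n)) := by
    rw [← Real.exp_nat_mul]
    refine Real.exp_le_exp.2 ?_
    nlinarith [mul_le_mul_of_nonneg_left h.le_q (show 0 ≤ 3 * ε / 4 * Real.log d by positivity)]
  have hbinom : (1 + d⁻¹) ^ (2 * n) ≤ Real.exp (2 * sideScale d n) := by
    refine (one_add_pow_le_exp (by positivity) _).trans (Real.exp_le_exp.2 ?_)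
    push_cast
    linarith [h.inv_mul_le_scale]
  have htwo := h.two_pow_le
  calc _ ≤ Real.exp (sideScale d n) *
        (Real.exp (-(3 * ε ^ 2 / 32 * Real.log d * sideScale d n)) *
          (Real.exp (6 * (K + 1) * sideScale d n) * Real.exp (2 * sideScale d n))) := by
        have htime := h.time_le
        gcongr
    _ = Real.exp (sideScale d n + (-(3 * ε ^ 2 / 32 * Real.log d * sideScale d n) +
          (6 * (K + 1) * sideScale d n + 2 * sideScale d n))) := by
        simp only [Real.exp_add]
    _ ≤ _ := by
        refine Real.exp_le_exp.2 ?_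
        nlinarith [mul_le_mul_of_nonneg_right h.le_log (show 0 ≤ sideScale d n by linarith)]

lemma choose_le (h : SizeBounds ε d n K s q) :
    (n.choose s : ℝ) ≤ Real.exp (Real.log d * s + sideScale d n) := by
  have hd := h.d_pos.le
  have hchoose := (choose_mul_pow_le (inv_nonneg.2 hd) n s).trans
    (one_add_pow_le_exp (inv_nonneg.2 hd) n)
  have hpow : d⁻¹ ^ s = Real.exp (-(Real.log d * s)) := by
    rw [h.inv_eq_exp, ← Real.exp_nat_mul]
    ring_nf
  rw [hpow, Real.exp_neg, ← div_eq_mul_inv, div_le_iff₀ (Real.exp_pos _), ← Real.exp_add]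
    at hchoose
  exact hchoose.trans (Real.exp_le_exp.2 (by linarith [h.inv_mul_le_scale]))

lemma choose_sq_mul_le (h : SizeBounds ε d n K s q) :
    (n.choose s : ℝ) ^ 2 * (1 - d / n) ^ (s * s) ≤
      Real.exp (Real.log d * sideScale d n + 3 * sideScale d n) := by
  have hΦ := h.eight_le_scale
  have hl := h.ten_le_log
  have hε := h.ε_pos
  have hp := h.prob_le_half
  have hindep : (1 - d / n) ^ (s * s) ≤ Real.exp (-((1 + ε) * Real.log d * s)) := by
    refine one_sub_pow_le_exp (by linarith) _ ?_
    rw [Nat.cast_mul, ← mul_assoc]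
    exact mul_le_mul_of_nonneg_right (h.mul_log_le h.le_s) s.cast_nonneg
  have hs : (1 - ε) * Real.log d * s ≤
      (1 - ε) * Real.log d * ((1 + ε) * sideScale d n + 1) :=
    mul_le_mul_of_nonneg_left h.s_le (mul_nonneg (by linarith [h.ε_le_one]) (by linarith))
  calc _ ≤ Real.exp (Real.log d * s + sideScale d n) ^ 2 *
        Real.exp (-((1 + ε) * Real.log d * s)) :=
        mul_le_mul (pow_le_pow_left₀ (Nat.cast_nonneg _) h.choose_le 2) hindep
          (pow_nonneg (by linarith) _) (by positivity)
    _ = Real.exp ((1 - ε) * Real.log d * s + 2 * sideScale d n) := by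
        rw [← Real.exp_nat_mul, ← Real.exp_add]
        push_cast
        ring_nf
    _ ≤ _ := by
        refine Real.exp_le_exp.2 ?_
        have hsq : 0 ≤ ε ^ 2 * (Real.log d * sideScale d n) := by positivity
        have hmul : 0 ≤ ε * Real.log d := by positivity
        linarith [h.log_le_scale]

lemma choose_sq_mul_exp_pow_le (h : SizeBounds ε d n K s q) :
    (n.choose s : ℝ) ^ 2 * (1 - d / n) ^ (s * s) *
        Real.exp (-(ε ^ 2 / 16 * Real.log d * sideScale d n)) ^ K ≤
      Real.exp (-(ε * Real.log d * sideScale d n)) := by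
  have hΦ := h.eight_le_scale
  have hl := h.ten_le_log
  have hlΦ : 0 ≤ Real.log d * sideScale d n := by positivity
  refine (mul_le_mul_of_nonneg_right h.choose_sq_mul_le (by positivity)).trans ?_
  rw [← Real.exp_nat_mul, ← Real.exp_add]
  refine Real.exp_le_exp.2 ?_
  have hK := mul_le_mul_of_nonneg_right h.le_K hlΦ
  have hε : ε * (Real.log d * sideScale d n) ≤ Real.log d * sideScale d n :=
    mul_le_of_le_one_left hlΦ h.ε_le_one
  nlinarith

lemma one_sub_pow_mul_self_le (h : SizeBounds ε d n K s q) :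
    (1 - d / n) ^ ((s - q) * (s - q)) ≤
      Real.exp (-((1 + 3 * ε / 2) * (Real.log d * sideScale d n))) := by
  have hΦ := h.eight_le_scale
  have hl := h.ten_le_log
  have hε := h.ε_pos
  refine one_sub_pow_le_exp (by linarith [h.prob_le_half]) _ ?_
  have hlog := h.mul_log_le h.le_sub
  have hsq : 0 ≤ ε ^ 2 * (Real.log d * sideScale d n) := by positivity
  calc (1 + 3 * ε / 2) * (Real.log d * sideScale d n)
      ≤ ((1 + 3 * ε / 4) * Real.log d) * ((1 + 3 * ε / 4) * sideScale d n) := by nlinarith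
    _ ≤ (d / n * (s - q : ℕ)) * (s - q : ℕ) :=
        mul_le_mul hlog h.le_sub (by positivity) (le_trans (by positivity) hlog)
    _ = d / n * ((s - q) * (s - q) : ℕ) := by
        rw [Nat.cast_mul, mul_assoc]

lemma choose_sq_mul_late_le (h : SizeBounds ε d n K s q) :
    (n.choose s : ℝ) ^ 2 * (1 - d / n) ^ (s * s) * ((K * (n : ℝ) ^ 2 + 1) *
        2 ^ ((K + 1) * (2 * s)) * (1 - d / n) ^ ((s - q) * (s - q))) ≤
      Real.exp (-(ε * Real.log d * sideScale d n)) := by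
  have hΦ := h.eight_le_scale
  have hl := h.ten_le_log
  have hε := h.ε_pos
  have hlΦ : 0 ≤ Real.log d * sideScale d n := by positivity
  have hp : 0 ≤ 1 - d / n := by linarith [h.prob_le_half]
  have hstart := h.choose_sq_mul_le
  have htime := h.time_le
  have htwo := h.two_pow_le
  have hlate := h.one_sub_pow_mul_self_le
  calc _ ≤ Real.exp (Real.log d * sideScale d n + 3 * sideScale d n) *
        (Real.exp (sideScale d n) * Real.exp (6 * (K + 1) * sideScale d n) *
          Real.exp (-((1 + 3 * ε / 2) * (Real.log d * sideScale d n)))) := by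
        gcongr
    _ = Real.exp (Real.log d * sideScale d n + 3 * sideScale d n + (sideScale d n +
          6 * (K + 1) * sideScale d n +
            -((1 + 3 * ε / 2) * (Real.log d * sideScale d n)))) := by
        simp only [Real.exp_add]
    _ ≤ _ := by
        refine Real.exp_le_exp.2 ?_
        have hlog := mul_le_mul_of_nonneg_right h.le_log (show 0 ≤ sideScale d n by linarith)
        have hsq : ε ^ 2 / 32 * (Real.log d * sideScale d n) ≤
            ε / 2 * (Real.log d * sideScale d n) :=
          mul_le_mul_of_nonneg_right (by nlinarith [h.ε_le_one]) hlΦ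
        nlinarith

lemma first_moment_le (h : SizeBounds ε d n K s q) :
    (n.choose s : ℝ) ^ 2 * (1 - d / n) ^ (s * s) *
        (Real.exp (-(ε ^ 2 / 16 * Real.log d * sideScale d n)) ^ K +
          K * ((K * (n : ℝ) ^ 2 + 1) * 2 ^ ((K + 1) * (2 * s)) *
            (1 - d / n) ^ ((s - q) * (s - q)))) ≤
      (K + 1) * Real.exp (-(ε * Real.log d * sideScale d n)) := by
  have hlate := mul_le_mul_of_nonneg_left h.choose_sq_mul_late_le (Nat.cast_nonneg (α := ℝ) K)
  linarith [h.choose_sq_mul_exp_pow_le]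

end SizeBounds

/-! ### Hardness for deterministic low-degree maps -/

section Asymptotics

open Filter

lemma eventually_mul_sq_add_one_le_exp (b : ℝ) {a : ℝ} (ha : 0 < a) :
    ∀ᶠ n : ℕ in atTop, b * (n : ℝ) ^ 2 + 1 ≤ Real.exp (a * n) := by
  have hlim : Tendsto (fun n : ℕ => (b * (n : ℝ) ^ 2 + 1) / Real.exp (a * n)) atTop (nhds 0) := by
    have hsq := ((isLittleO_pow_exp_pos_mul_atTop 2 ha).const_mul_left b).add
      (isLittleO_pow_exp_pos_mul_atTop 0 ha)
    simpa using (hsq.comp_tendsto tendsto_natCast_atTop_atTop).tendsto_div_nhds_zero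
  filter_upwards [hlim.eventually_le_const one_pos] with n hn
  exact (div_le_one (Real.exp_pos _)).1 hn

lemma eventually_mul_sq_add_one_le_pow (b : ℝ) :
    ∀ᶠ n : ℕ in atTop, 6 * (b * (n : ℝ) ^ 2 + 1) ≤ (n : ℝ) ^ 5 := by
  filter_upwards [eventually_ge_atTop 1,
    tendsto_natCast_atTop_atTop.eventually_ge_atTop (6 * b + 6)] with n hn hb
  have hn' : (1 : ℝ) ≤ n := by exact_mod_cast hn
  calc 6 * (b * (n : ℝ) ^ 2 + 1) ≤ (6 * b + 6) * (n : ℝ) ^ 2 := by nlinarith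
    _ ≤ n * (n : ℝ) ^ 2 := mul_le_mul_of_nonneg_right hb (by positivity)
    _ = (n : ℝ) ^ 3 := by ring
    _ ≤ (n : ℝ) ^ 5 := pow_le_pow_right₀ hn' (by norm_num)

lemma eventually_le_mul_natCast (b : ℝ) {a : ℝ} (ha : 0 < a) : ∀ᶠ n : ℕ in atTop, b ≤ a * n :=
  (tendsto_natCast_atTop_atTop.const_mul_atTop ha).eventually_ge_atTop b

lemma eventually_sizeBounds {ε d : ℝ} {K : ℕ} (hε : 0 < ε) (hε1 : ε ≤ 1) (hd : 0 < d)
    (hlog : 6 * ((K : ℝ) + 1) + 4 ≤ ε ^ 2 / 32 * Real.log d) (hK : 48 ≤ K * ε ^ 2) :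
    ∀ᶠ n : ℕ in atTop,
      SizeBounds ε d n K ⌈(1 + ε) * sideScale d n⌉₊ ⌈ε / 8 * sideScale d n⌉₊ := by
  have hlog0 : 0 < Real.log d :=
    pos_of_mul_pos_right (lt_of_lt_of_le (by positivity) hlog) (by positivity)
  have ha : 0 < Real.log d / d := div_pos hlog0 hd
  filter_upwards [eventually_mul_sq_add_one_le_exp K ha,
    eventually_le_mul_natCast 8 (mul_pos hε ha), eventually_le_mul_natCast (Real.log d) ha,
    eventually_le_mul_natCast (2 * d) one_pos] with n htime hscale hle hn
  have hscale0 : 0 ≤ sideScale d n := mul_nonneg ha.le n.cast_nonneg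
  exact ⟨hε, hε1, hd, hlog, hK, by rwa [mul_assoc] at hscale, hle, htime, by rwa [one_mul] at hn,
    Nat.le_ceil _, (Nat.ceil_lt_add_one (by positivity)).le, Nat.le_ceil _,
    (Nat.ceil_lt_add_one (by positivity)).le⟩

end Asymptotics

lemma coe_edgeProb {n : ℕ} {d : ℝ} (h0 : 0 ≤ d) (hn : d ≤ n) : (edgeProb n d : ℝ) = d / n := by
  rw [edgeProb, Set.projIcc_of_mem _
    ⟨div_nonneg h0 n.cast_nonneg, div_le_one_of_le₀ hn n.cast_nonneg⟩]

namespace SizeBounds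

variable {ε d : ℝ} {n K s q D : ℕ} {f : (BipEdge n → Bool) → BipVertex n → ℝ}

lemma coe_edgeProb (h : SizeBounds ε d n K s q) : (edgeProb n d : ℝ) = d / n :=
  _root_.coe_edgeProb h.d_pos.le (by linarith [h.le_n, h.d_pos])

lemma one_le_log (h : SizeBounds ε d n K s q) : 1 ≤ Real.log n := by
  have hd := h.d_pos
  linarith [h.ten_le_log, Real.log_le_log hd (show d ≤ n by linarith [h.le_n])]

lemma scale_pos (h : SizeBounds ε d n K s q) : 0 < sideScale d n := by
  linarith [h.eight_le_scale]

lemma binEntropy_mul_le (h : SizeBounds ε d n K s q) {ξ Γ : ℝ} (hΓ0 : 0 ≤ Γ) (hΓ : Γ ≤ 6 * ξ * n) :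
    Real.binEntropy (d / n) *
        (K * (D * Γ / (ε / 64 * sideScale d n * (d / n * (1 - d / n))))) ≤
      1536 * K / (ε * (Real.log d / d)) * (ξ * D * Real.log n) := by
  have hε := h.ε_pos
  have hΦ := h.scale_pos
  have hn := h.n_pos
  have hd := h.d_pos
  have hp0 := h.prob_pos
  have hp1 : 0 < 1 - d / n := by linarith [h.prob_le_half]
  have hlogn := h.one_le_log
  have hlogd := h.ten_le_log
  have hentropy := binEntropy_le_mul h.prob_pos h.prob_le_half (a := Real.log n) (by
    rw [Real.log_div hd.ne' hn.ne']
    linarith) hlogn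
  calc _ ≤ 4 * Real.log n * (d / n * (1 - d / n)) *
        (K * (D * Γ / (ε / 64 * sideScale d n * (d / n * (1 - d / n))))) :=
        mul_le_mul_of_nonneg_right hentropy (by positivity)
    _ = 256 * K * D * Real.log n / (ε * sideScale d n) * Γ := by
        generalize d / (n : ℝ) = p at hp0 hp1
        field_simp
        ring
    _ ≤ 256 * K * D * Real.log n / (ε * sideScale d n) * (6 * ξ * n) :=
        mul_le_mul_of_nonneg_left hΓ (by positivity)
    _ = 1536 * K / (ε * (Real.log d / d)) * (ξ * D * Real.log n) := by
        unfold sideScale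
        field_simp
        ring

lemma exp_neg_le (h : SizeBounds ε d n K s q)
    (hf : ∀ v, (fun A => f A v) ∈ lowDegree (edgeProb n d) D) {ξ : ℝ}
    (hΓ : ∫ A, ∑ v, f A v ^ 2 ∂randomBip n d ≤ 6 * ξ * n) :
    Real.exp (-(1536 * K / (ε * (Real.log d / d)) * (ξ * D * Real.log n))) ≤
      (K * (n : ℝ) ^ 2 + 1) *
          (randomBip n d).real {A | ¬ RoundsTo (ε / 16 * (Real.log d / d)) s f A} +
        (K + 1) * Real.exp (-(ε * Real.log d * sideScale d n)) := by
  have hp := h.coe_edgeProb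
  have hp0 := h.prob_pos
  have hp1 := h.prob_le_half
  have hε := h.ε_pos
  have hΦ := h.scale_pos
  have hl := h.ten_le_log
  have hΓ0 : 0 ≤ ∫ A, ∑ v, f A v ^ 2 ∂randomBip n d :=
    integral_nonneg fun A => Finset.sum_nonneg fun v _ => sq_nonneg _
  have hq : 4 * (ε / 64 * sideScale d n) + ε / 16 * (Real.log d / d) * n ≤ q :=
    le_trans (le_of_eq (by unfold sideScale; ring)) h.le_q
  obtain ⟨σ, hσ, hlower⟩ := exp_le_measureReal_avoidsBad_jumpSq (K := K)
    (c := ε / 64 * sideScale d n) (by exact_mod_cast h.n_pos) (by rwa [hp])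
    (by rw [hp]; linarith) hf (by positivity) rfl
  have hstep := h.one_step_le
  have hupper := measureReal_avoidsBad_jumpSq_le (p := edgeProb n d) (f := f) (K := K)
    (w := Real.exp (-(3 * ε / 4 * Real.log d)))
    (β := Real.exp (-(ε ^ 2 / 16 * Real.log d * sideScale d n))) hσ le_rfl h.s_pos hq
    (by positivity) h.q_le_s (inv_nonneg.2 h.d_pos.le) (Real.exp_pos _).le
    (Real.exp_le_one_iff.2 (neg_nonpos.2 (by positivity))) (by rw [hp]; exact h.one_sub_pow_le)
    le_rfl (by push_cast; exact hstep) (Real.exp_le_one_iff.2 (neg_nonpos.2 (by positivity)))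
  rw [hp] at hlower hupper
  push_cast at hupper
  exact (Real.exp_le_exp.2 (neg_le_neg (h.binEntropy_mul_le hΓ0 hΓ))).trans
    (hlower.trans (hupper.trans (add_le_add_right h.first_moment_le _)))

end SizeBounds

lemma mul_exp_neg_le_half_exp {a C X x : ℝ} (hx : 0 < x) (ha : 6 * a ≤ x ^ 5)
    (hX : Real.log x ≤ X) : a * (3 * Real.exp (-((C + 5) * X))) ≤ 1 / 2 * Real.exp (-(C * X)) := by
  have hpow : x ^ 5 * Real.exp (-(5 * X)) ≤ 1 := by
    rw [← Real.exp_log (pow_pos hx 5), ← Real.exp_add, Real.log_pow]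
    exact Real.exp_le_one_iff.2 (by push_cast; linarith)
  have hsplit : Real.exp (-((C + 5) * X)) = Real.exp (-(5 * X)) * Real.exp (-(C * X)) := by
    rw [← Real.exp_add]
    ring_nf
  rw [hsplit]
  nlinarith [mul_le_mul_of_nonneg_right ha (Real.exp_pos (-(5 * X))).le,
    Real.exp_pos (-(C * X))]

lemma mul_exp_neg_lt_half_exp {a t u : ℝ} (ha : 2 * a ≤ u) (ht : t ≤ u) :
    a * Real.exp (-(2 * u)) < 1 / 2 * Real.exp (-t) := by
  have hu : a * Real.exp (-u) < 1 / 2 := by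
    rw [Real.exp_neg, ← div_eq_mul_inv, div_lt_div_iff₀ (Real.exp_pos _) two_pos]
    linarith [Real.add_one_le_exp u]
  calc a * Real.exp (-(2 * u)) = a * Real.exp (-u) * Real.exp (-u) := by
        rw [mul_assoc, ← Real.exp_add]
        ring_nf
    _ < 1 / 2 * Real.exp (-u) := mul_lt_mul_of_pos_right hu (Real.exp_pos _)
    _ ≤ 1 / 2 * Real.exp (-t) :=
        mul_le_mul_of_nonneg_left (Real.exp_le_exp.2 (neg_le_neg ht)) (by norm_num)

lemma eventually_lt_measureReal_not_roundsTo {ε d : ℝ} {K : ℕ} (hε : 0 < ε) (hε1 : ε ≤ 1)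
    (hd : 0 < d) (hlog : 6 * ((K : ℝ) + 1) + 4 ≤ ε ^ 2 / 32 * Real.log d)
    (hK : 48 ≤ K * ε ^ 2) :
    ∃ η C₁ C₂ : ℝ, 0 < η ∧ 0 < C₁ ∧ 0 < C₂ ∧ ∀ᶠ n : ℕ in Filter.atTop,
      ∀ ξ : ℝ, 1 ≤ ξ → ∀ D : ℕ, 1 ≤ D → (D : ℝ) ≤ C₁ * n / (ξ * Real.log n) →
      ∀ f : (BipEdge n → Bool) → BipVertex n → ℝ,
        (∀ v, (fun A => f A v) ∈ lowDegree (edgeProb n d) D) →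
        ∫ A, ∑ v, f A v ^ 2 ∂randomBip n d ≤ 6 * ξ * n →
        3 * Real.exp (-(C₂ * ξ * D * Real.log n)) <
          (randomBip n d).real {A | ¬ RoundsTo η ⌈(1 + ε) * sideScale d n⌉₊ f A} := by
  have hlog0 : 0 < Real.log d :=
    pos_of_mul_pos_right (lt_of_lt_of_le (by positivity) hlog) (by positivity)
  have hK0 : (0 : ℝ) < K := pos_of_mul_pos_left (lt_of_lt_of_le (by norm_num) hK) (sq_nonneg ε)
  set C := 1536 * K / (ε * (Real.log d / d))
  have hC0 : 0 < C := by positivity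
  set κ := ε * Real.log d * (Real.log d / d) / 2 with hκ
  have hκ0 : 0 < κ := by positivity
  refine ⟨ε / 16 * (Real.log d / d), κ / C, C + 5, by positivity, by positivity, by positivity, ?_⟩
  filter_upwards [eventually_sizeBounds hε hε1 hd hlog hK, eventually_mul_sq_add_one_le_pow K,
    eventually_le_mul_natCast (2 * ((K : ℝ) + 1)) hκ0] with n h hpow hκn ξ hξ D hD hDle f hf hΓ
  have hlogn := h.one_le_log
  set X := ξ * D * Real.log n
  have hXlog : Real.log n ≤ X :=
    le_mul_of_one_le_left (by linarith) (one_le_mul_of_one_le_of_one_le hξ (by exact_mod_cast hD))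
  have hCX : C * X ≤ κ * n := by
    rw [le_div_iff₀ (by positivity), div_mul_eq_mul_div, le_div_iff₀ hC0] at hDle
    linarith
  have hlower := h.exp_neg_le hf hΓ
  have hchains := mul_exp_neg_lt_half_exp hκn hCX
  have hround := mul_exp_neg_le_half_exp (C := C) h.n_pos hpow hXlog
  have hexponent : 2 * (κ * n) = ε * Real.log d * sideScale d n := by
    rw [hκ, sideScale]
    ring
  rw [hexponent] at hchains
  rw [mul_assoc (C + 5), mul_assoc (C + 5)]
  by_contra! hfail
  have hmul := mul_le_mul_of_nonneg_left hfail (show (0 : ℝ) ≤ K * n ^ 2 + 1 by positivity)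
  linarith

lemma exists_forall_eventually_lt_measureReal_not_roundsTo {ε : ℝ} (hε : 0 < ε) (hε1 : ε ≤ 1) :
    ∃ d₀ : ℝ, 1 < d₀ ∧ ∀ d : ℝ, d₀ ≤ d →
      ∃ η C₁ C₂ : ℝ, 0 < η ∧ 0 < C₁ ∧ 0 < C₂ ∧ ∀ᶠ n : ℕ in Filter.atTop,
        ∀ ξ : ℝ, 1 ≤ ξ → ∀ D : ℕ, 1 ≤ D → (D : ℝ) ≤ C₁ * n / (ξ * Real.log n) →
        ∀ f : (BipEdge n → Bool) → BipVertex n → ℝ,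
          (∀ v, (fun A => f A v) ∈ lowDegree (edgeProb n d) D) →
          ∫ A, ∑ v, f A v ^ 2 ∂randomBip n d ≤ 6 * ξ * n →
          3 * Real.exp (-(C₂ * ξ * D * Real.log n)) <
            (randomBip n d).real {A | ¬ RoundsTo η ⌈(1 + ε) * sideScale d n⌉₊ f A} := by
  obtain ⟨K, hK⟩ := exists_nat_ge (48 / ε ^ 2)
  rw [div_le_iff₀ (by positivity)] at hK
  refine ⟨Real.exp ((6 * ((K : ℝ) + 1) + 4) / (ε ^ 2 / 32)), Real.one_lt_exp_iff.2 (by positivity),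
    fun d hd => ?_⟩
  have hd0 : 0 < d := (Real.exp_pos _).trans_le hd
  rw [← Real.le_log_iff_exp_le hd0, div_le_iff₀' (by positivity)] at hd
  exact eventually_lt_measureReal_not_roundsTo hε hε1 hd0 hd hK

/-! ### Fixing the internal randomness -/

section Measurability

variable {Ω : Type*} [MeasurableSpace Ω] {n D : ℕ} {f : Ω → BipPoly n}

lemma measurable_eval_of_totalDegree_le {σ : Type*} [Finite σ] {F : Ω → MvPolynomial σ ℝ}
    (hD : ∀ ω, (F ω).totalDegree ≤ D) (hF : ∀ m, Measurable fun ω => (F ω).coeff m)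
    (x : σ → ℝ) : Measurable fun ω => MvPolynomial.eval x (F ω) := by
  have hfin : {m : σ →₀ ℕ | m.degree ≤ D}.Finite := Finsupp.finite_of_degree_le D
  have heval (ω : Ω) : MvPolynomial.eval x (F ω) =
      ∑ m ∈ hfin.toFinset, (F ω).coeff m * ∏ i ∈ m.support, x i ^ m i := by
    rw [MvPolynomial.eval_eq]
    refine Finset.sum_subset (fun m hm => ?_) fun m _ hm => ?_
    · exact hfin.mem_toFinset.2 ((MvPolynomial.le_totalDegree hm).trans (hD ω))
    · rw [MvPolynomial.notMem_support_iff.1 hm, zero_mul]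
  simp only [heval]
  exact Finset.measurable_fun_sum _ fun m _ => (hF m).mul_const _

lemma IsRandomPoly.measurable_value (hf : IsRandomPoly D f) (A : BipEdge n → Bool) :
    Measurable fun ω => (f ω).value A :=
  measurable_pi_lambda _ fun v =>
    measurable_eval_of_totalDegree_le (fun ω => hf.degreeLE ω v) (hf.measurable_coeff v) _

lemma measurableSet_roundedSet (η : ℝ) (A : BipEdge n → Bool)
    (Q : Finset (BipVertex n) → Prop) :
    MeasurableSet {x : BipVertex n → ℝ | Q (roundedSet η A x)} := by
  let pattern : (BipVertex n → ℝ) → (BipVertex n → Prop) × (BipVertex n → Prop) :=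
    fun x => (fun v => 1 ≤ x v, fun v => 1 / 2 < x v ∧ x v < 1)
  have hpattern : Measurable pattern :=
    (measurable_pi_lambda _ fun v => measurableSet_setOfPred.1
        (measurable_pi_apply v measurableSet_Ici)).prodMk
      (measurable_pi_lambda _ fun v => measurableSet_setOfPred.1
        (measurable_pi_apply v measurableSet_Ioo))
  have hfactor (x y : BipVertex n → ℝ) (h : pattern x = pattern y) :
      roundedSet η A x = roundedSet η A y := by
    have hI : roundI x = roundI y :=
      Finset.filter_congr fun v _ => iff_of_eq (congrFun (congrArg Prod.fst h) v)
    have hJ : roundJ x = roundJ y :=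
      Finset.filter_congr fun v _ => iff_of_eq (congrFun (congrArg Prod.snd h) v)
    unfold roundedSet roundITilde
    rw [hI, hJ]
  convert hpattern (MeasurableSet.of_discrete (s := pattern '' {x | Q (roundedSet η A x)}))
    using 1
  refine (Set.subset_preimage_image _ _).antisymm ?_
  rintro x ⟨y, hy, hxy⟩
  exact (hfactor y x hxy ▸ hy : Q (roundedSet η A x))

lemma IsRandomPoly.measurableSet_roundedSet (hf : IsRandomPoly D f) (η : ℝ)
    (Q : Finset (BipVertex n) → Prop) :
    MeasurableSet {z : (BipEdge n → Bool) × Ω | Q (roundedSet η z.1 ((f z.2).value z.1))} :=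
  measurableSet_setOfPred.2 <| measurable_from_prod_countable_right fun A =>
    measurableSet_setOfPred.1 (hf.measurable_value A (_root_.measurableSet_roundedSet η A Q))

lemma IsRandomPoly.measurable_sum_sq (hf : IsRandomPoly D f) :
    Measurable fun z : (BipEdge n → Bool) × Ω =>
      ENNReal.ofReal (∑ v, (f z.2).value z.1 v ^ 2) :=
  measurable_from_prod_countable_right fun A => ENNReal.measurable_ofReal.comp <|
    Finset.measurable_fun_sum _ fun v _ =>
      ((measurable_pi_apply v).comp (hf.measurable_value A)).pow_const 2

end Measurability

lemma exists_le_two_mul_of_lintegral_le {Ω : Type*} [MeasurableSpace Ω] {P : Measure Ω}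
    [IsProbabilityMeasure P] {g h : Ω → ℝ≥0∞} {a b : ℝ} (hg : Measurable g) (hh : Measurable h)
    (ha : 0 < a) (hb : 0 < b) (hga : ∫⁻ ω, g ω ∂P ≤ ENNReal.ofReal a)
    (hhb : ∫⁻ ω, h ω ∂P ≤ ENNReal.ofReal b) :
    ∃ ω, g ω ≤ ENNReal.ofReal (2 * a) ∧ h ω ≤ ENNReal.ofReal (2 * b) := by
  have hmean : ∫⁻ ω, (g ω / ENNReal.ofReal a + h ω / ENNReal.ofReal b) ∂P ≤ 2 := by
    rw [lintegral_add_left (hg.div_const _)]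
    simp only [div_eq_mul_inv]
    rw [lintegral_mul_const _ hg, lintegral_mul_const _ hh, ← div_eq_mul_inv,
      ← div_eq_mul_inv, ← one_add_one_eq_two]
    exact add_le_add (ENNReal.div_le_of_le_mul (by simpa using hga))
      (ENNReal.div_le_of_le_mul (by simpa using hhb))
  obtain ⟨ω, hω⟩ := exists_le_lintegral (μ := P)
    ((hg.div_const (ENNReal.ofReal a)).add (hh.div_const (ENNReal.ofReal b))).aemeasurable
  have hcancel {x : ℝ≥0∞} {c : ℝ} (hc : 0 < c) (hx : x / ENNReal.ofReal c ≤ 2) :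
      x ≤ ENNReal.ofReal (2 * c) := by
    rw [ENNReal.div_le_iff (by simpa using hc) ENNReal.ofReal_ne_top] at hx
    rwa [ENNReal.ofReal_mul zero_le_two, ENNReal.ofReal_ofNat]
  exact ⟨ω, hcancel ha (le_self_add.trans (hω.trans hmean)),
    hcancel hb (le_add_self.trans (hω.trans hmean))⟩

instance {n : ℕ} {d : ℝ} : IsProbabilityMeasure (randomBip n d) :=
  inferInstanceAs (IsProbabilityMeasure (bernoulliCube (BipEdge n) (edgeProb n d)))

lemma Optimizes.exists_realization {Ω : Type*} [MeasurableSpace Ω] {P : Measure Ω}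
    [IsProbabilityMeasure P] {n D : ℕ} {d kl kr δ ξ η : ℝ} {f : Ω → BipPoly n}
    (hf : IsRandomPoly D f) (hk : 0 < ξ * (kl + kr)) (hδ : 0 < δ)
    (h : Optimizes P n d kl kr δ ξ η f) :
    ∃ ω, ∫ A, ∑ v, (f ω).value A v ^ 2 ∂randomBip n d ≤ 2 * (ξ * (kl + kr)) ∧
      (randomBip n d).real {A | ¬ (kl ≤ leftCard (roundedSet η A ((f ω).value A)) ∧
        kr ≤ rightCard (roundedSet η A ((f ω).value A)))} ≤ 2 * δ := by
  obtain ⟨hnorm, hprob⟩ := h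
  have hmeas := hf.measurableSet_roundedSet η fun S => kl ≤ leftCard S ∧ kr ≤ rightCard S
  have hfail : ((randomBip n d).prod P)
      {z | kl ≤ leftCard (roundedSet η z.1 ((f z.2).value z.1)) ∧
         kr ≤ rightCard (roundedSet η z.1 ((f z.2).value z.1))}ᶜ ≤ ENNReal.ofReal δ := by
    rw [prob_compl_eq_one_sub hmeas]
    refine (tsub_le_tsub_left hprob 1).trans ?_
    rw [tsub_le_iff_right, ← ENNReal.ofReal_one]
    calc ENNReal.ofReal 1 = ENNReal.ofReal (δ + (1 - δ)) := by rw [add_sub_cancel]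
      _ ≤ _ := ENNReal.ofReal_add_le
  rw [lintegral_prod_symm' _ hf.measurable_sum_sq] at hnorm
  rw [Measure.prod_apply_symm hmeas.compl] at hfail
  obtain ⟨ω, hω, hω'⟩ := exists_le_two_mul_of_lintegral_le
    hf.measurable_sum_sq.lintegral_prod_left' (measurable_measure_prodMk_right hmeas.compl)
    hk hδ hnorm hfail
  refine ⟨ω, ?_, ENNReal.toReal_le_of_le_ofReal (by positivity) hω'⟩
  rw [integral_eq_lintegral_of_nonneg_ae
    (ae_of_all _ fun A => Finset.sum_nonneg fun v _ => sq_nonneg _) .of_discrete]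
  exact ENNReal.toReal_le_of_le_ofReal (by positivity) hω

lemma leftCard_eq_card_toLeft {n : ℕ} (S : Finset (BipVertex n)) : leftCard S = S.toLeft.card := by
  rw [leftCard, ← Finset.card_map (s := S.toLeft) Function.Embedding.inl]
  congr 1
  ext (i | i) <;> simp

lemma rightCard_eq_card_toRight {n : ℕ} (S : Finset (BipVertex n)) :
    rightCard S = S.toRight.card := by
  rw [rightCard, ← Finset.card_map (s := S.toRight) Function.Embedding.inr]
  congr 1
  ext (i | i) <;> simp

lemma leftCard_le {n : ℕ} (S : Finset (BipVertex n)) : leftCard S ≤ n := by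
  rw [leftCard_eq_card_toLeft]
  exact (Finset.card_le_univ _).trans (by simp)

lemma rightCard_le {n : ℕ} (S : Finset (BipVertex n)) : rightCard S ≤ n := by
  rw [rightCard_eq_card_toRight]
  exact (Finset.card_le_univ _).trans (by simp)

lemma not_optimizes_of_lt_measureReal_not_roundsTo {n D : ℕ} {d kl kr δ ξ η q s : ℝ}
    {Ω : Type*} [MeasurableSpace Ω] {P : Measure Ω} [IsProbabilityMeasure P]
    {f : Ω → BipPoly n} (hf : IsRandomPoly D f) (hξ : 0 < ξ) (hs : 0 < s) (hkl : s ≤ kl)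
    (hkr : s ≤ kr) (hq : 0 < q) (hδ : δ ≤ q)
    (H : ∀ g : (BipEdge n → Bool) → BipVertex n → ℝ,
      (∀ v, (fun A => g A v) ∈ lowDegree (edgeProb n d) D) →
      ∫ A, ∑ v, g A v ^ 2 ∂randomBip n d ≤ 6 * ξ * n →
      3 * q < (randomBip n d).real {A | ¬ RoundsTo η ⌈s⌉₊ g A}) :
    ¬ Optimizes P n d kl kr δ ξ η f := by
  intro hopt
  have hq1 : 3 * q < 1 := (H 0 (fun _ => Submodule.zero_mem _)
    (by simpa using (by positivity : 0 ≤ 6 * ξ * n))).trans_le measureReal_le_one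
  obtain ⟨ω, henergy, hfail⟩ := Optimizes.exists_realization hf
    (mul_pos hξ (by linarith)) hq ⟨hopt.1, (ENNReal.ofReal_le_ofReal (by linarith)).trans hopt.2⟩
  obtain ⟨A, hAl, hAr⟩ : ∃ A, kl ≤ leftCard (roundedSet η A ((f ω).value A)) ∧
      kr ≤ rightCard (roundedSet η A ((f ω).value A)) := by
    by_contra hnone
    simp only [not_exists.1 hnone, not_false_eq_true, Set.ofPred_true, probReal_univ] at hfail
    linarith
  have hln : kl ≤ n := hAl.trans (Nat.cast_le.2 (leftCard_le _))
  have hrn : kr ≤ n := hAr.trans (Nat.cast_le.2 (rightCard_le _))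
  refine (H (fun A => (f ω).value A)
    (fun v => eval_bits_mem_lowDegree (hf.degreeLE ω v)) (henergy.trans ?_)).not_ge ?_
  · nlinarith [mul_le_mul_of_nonneg_left (add_le_add hln hrn) hξ.le,
      mul_nonneg hξ.le (Nat.cast_nonneg (α := ℝ) n)]
  · refine (measureReal_mono ?_).trans (hfail.trans (by linarith))
    rintro A hA ⟨hl, hr⟩
    rw [leftCard_eq_card_toLeft] at hl
    rw [rightCard_eq_card_toRight] at hr
    exact hA ⟨Nat.ceil_le.2 (hkl.trans hl), Nat.ceil_le.2 (hkr.trans hr)⟩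

lemma exists_forall_not_optimizes {ε : ℝ} (hε : 0 < ε) :
    ∃ d₀ : ℝ, 0 < d₀ ∧ ∀ d : ℝ, d₀ ≤ d →
      ∃ (n₀ : ℕ) (η C₁ C₂ : ℝ), 0 < n₀ ∧ 0 < η ∧ 0 < C₁ ∧ 0 < C₂ ∧
      ∀ n : ℕ, n₀ ≤ n → ∀ kl kr : ℝ, (1 + ε) * (Real.log d / d) * n ≤ min kl kr →
      ∀ ξ : ℝ, 1 ≤ ξ → ∀ D : ℕ, 1 ≤ D → (D : ℝ) ≤ C₁ * n / (ξ * Real.log n) →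
      ∀ δ : ℝ, δ ≤ Real.exp (-(C₂ * ξ * D * Real.log n)) →
      ∀ (Ω : Type*) [MeasurableSpace Ω] (P : Measure Ω) [IsProbabilityMeasure P]
        (f : Ω → BipPoly n), IsRandomPoly D f → ¬ Optimizes P n d kl kr δ ξ η f := by
  obtain ⟨d₀, hd₀, H⟩ := exists_forall_eventually_lt_measureReal_not_roundsTo
    (lt_min hε one_pos) (min_le_right ε 1)
  refine ⟨d₀, one_pos.trans hd₀, fun d hd => ?_⟩
  obtain ⟨η, C₁, C₂, hη, hC₁, hC₂, H⟩ := H d hd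
  obtain ⟨n₀, H⟩ := Filter.eventually_atTop.1 (H.and (Filter.eventually_ge_atTop 1))
  refine ⟨max n₀ 1, η, C₁, C₂, by positivity, hη, hC₁, hC₂, ?_⟩
  intro n hn kl kr hk ξ hξ D hD hDle δ hδ Ω _ P _ f hf
  obtain ⟨Hn, hn1⟩ := H n (le_of_max_le_left hn)
  have hscale : 0 < sideScale d n := mul_pos
    (div_pos (Real.log_pos (hd₀.trans_le hd)) (one_pos.trans (hd₀.trans_le hd)))
    (Nat.cast_pos.2 hn1)
  have hthreshold : (1 + min ε 1) * sideScale d n ≤ min kl kr := by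
    refine le_trans ?_ hk
    rw [mul_assoc]
    exact mul_le_mul_of_nonneg_right (by linarith [min_le_left ε 1]) hscale.le
  exact not_optimizes_of_lt_measureReal_not_roundsTo hf (one_pos.trans_le hξ)
    (mul_pos (add_pos one_pos (lt_min hε one_pos)) hscale) (hthreshold.trans (min_le_left _ _))
    (hthreshold.trans (min_le_right _ _)) (Real.exp_pos _) hδ (Hn ξ hξ D hD hDle)

/-! ### A degree-one polynomial below the threshold -/

/-- The degree-one map that selects `S` on the left and, within `T`, the vertices on the right
without neighbours in `S`. -/
noncomputable def greedyPoly {n : ℕ} (S T : Finset (Fin n)) : BipPoly n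
  | Sum.inl i => if i ∈ S then 1 else 0
  | Sum.inr j => if j ∈ T then 1 - ∑ i ∈ S, MvPolynomial.X (i, j) else 0

/-- The vertices of `T` on the right without neighbours in the set `S` on the left. -/
def freeVertices {n : ℕ} (S T : Finset (Fin n)) (A : BipEdge n → Bool) : Finset (Fin n) :=
  T.filter fun j => ∀ i ∈ S, A (i, j) = false

section Greedy

variable {n : ℕ} {S T : Finset (Fin n)} {A : BipEdge n → Bool}

lemma greedyPoly_degreeLE : (greedyPoly S T).DegreeLE 1 := by
  rintro (i | j)
  · simp only [greedyPoly]
    split_ifs <;> simp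
  · simp only [greedyPoly]
    split_ifs
    · exact (MvPolynomial.totalDegree_sub _ _).trans
        (max_le (by simp) (MvPolynomial.totalDegree_finsetSum_le fun i _ => by simp))
    · simp

lemma greedyPoly_value_inl (i : Fin n) :
    (greedyPoly S T).value A (Sum.inl i) = if i ∈ S then 1 else 0 := by
  simp only [BipPoly.value, greedyPoly]
  split_ifs <;> simp

lemma greedyPoly_value_inr (j : Fin n) :
    (greedyPoly S T).value A (Sum.inr j) =
      if j ∈ T then 1 - ∑ i ∈ S, edgeVector A (i, j) else 0 := by
  simp only [BipPoly.value, greedyPoly]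
  split_ifs <;> simp

lemma greedyPoly_value_of_mem {v : BipVertex n} (hv : v ∈ S.disjSum (freeVertices S T A)) :
    (greedyPoly S T).value A v = 1 := by
  rcases v with i | j
  · rw [greedyPoly_value_inl, if_pos (Finset.inl_mem_disjSum.1 hv)]
  · obtain ⟨hj, hfree⟩ := Finset.mem_filter.1 (Finset.inr_mem_disjSum.1 hv)
    rw [greedyPoly_value_inr, if_pos hj,
      Finset.sum_eq_zero fun i hi => by simp [edgeVector, hfree i hi], sub_zero]

lemma greedyPoly_value_of_notMem {v : BipVertex n} (hv : v ∉ S.disjSum (freeVertices S T A)) :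
    (greedyPoly S T).value A v ≤ 0 := by
  rcases v with i | j
  · rw [greedyPoly_value_inl, if_neg (mt Finset.inl_mem_disjSum.2 hv)]
  · rw [greedyPoly_value_inr]
    split_ifs with hj
    · rw [Finset.inr_mem_disjSum, freeVertices, Finset.mem_filter, not_and] at hv
      obtain ⟨i, hi, hA⟩ : ∃ i ∈ S, A (i, j) = true := by simpa using hv hj
      have hone := Finset.single_le_sum (f := fun i => edgeVector A (i, j))
        (fun i _ => by unfold edgeVector; positivity) hi
      simp only [edgeVector, hA, if_true] at hone ⊢
      linarith
    · exact le_rfl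

lemma roundI_greedyPoly :
    roundI ((greedyPoly S T).value A) = S.disjSum (freeVertices S T A) := by
  ext v
  rw [roundI, Finset.mem_filter_univ]
  by_cases hv : v ∈ S.disjSum (freeVertices S T A)
  · simp only [hv, greedyPoly_value_of_mem hv, le_rfl]
  · simp only [hv, iff_false, not_le]
    exact (greedyPoly_value_of_notMem hv).trans_lt one_pos

lemma roundJ_greedyPoly : roundJ ((greedyPoly S T).value A) = ∅ := by
  rw [roundJ, Finset.filter_eq_empty_iff]
  rintro v - ⟨hhalf, hone⟩
  by_cases hv : v ∈ S.disjSum (freeVertices S T A)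
  · exact hone.ne (greedyPoly_value_of_mem hv)
  · linarith [greedyPoly_value_of_notMem hv]

lemma not_adj_of_mem_disjSum_freeVertices {v w : BipVertex n}
    (hv : v ∈ S.disjSum (freeVertices S T A)) (hw : w ∈ S.disjSum (freeVertices S T A)) :
    ¬ (bipGraph A).Adj v w := by
  have hfree {i j : Fin n} (hi : i ∈ S) (hj : j ∈ freeVertices S T A) : A (i, j) = false :=
    (Finset.mem_filter.1 hj).2 i hi
  rintro (⟨i, j, rfl, rfl, hA⟩ | ⟨i, j, rfl, rfl, hA⟩)
  · simp [hfree (Finset.inl_mem_disjSum.1 hv) (Finset.inr_mem_disjSum.1 hw)] at hA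
  · simp [hfree (Finset.inl_mem_disjSum.1 hw) (Finset.inr_mem_disjSum.1 hv)] at hA

lemma roundedSet_greedyPoly :
    roundedSet 0 A ((greedyPoly S T).value A) = S.disjSum (freeVertices S T A) := by
  classical
  have hindep : roundITilde A ((greedyPoly S T).value A) = S.disjSum (freeVertices S T A) := by
    rw [roundITilde, roundI_greedyPoly, Finset.filter_eq_self]
    exact fun v hv w hw => not_adj_of_mem_disjSum_freeVertices hv hw
  rw [roundedSet, hindep, roundI_greedyPoly, roundJ_greedyPoly]
  simp

end Greedy

section Moments

lemma indepFun_bernoulliCube_of_dependsOn {ι : Type*} [Fintype ι] {p : unitInterval}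
    {U V : Finset ι} (hUV : Disjoint U V) {F G : (ι → Bool) → ℝ} (hF : DependsOn F U)
    (hG : DependsOn G V) : F ⟂ᵢ[bernoulliCube ι p] G := by
  obtain ⟨F', rfl⟩ := dependsOn_iff_exists_comp.1 hF
  obtain ⟨G', rfl⟩ := dependsOn_iff_exists_comp.1 hG
  have hcoord : iIndepFun (fun i (x : ι → Bool) => x i) (bernoulliCube ι p) :=
    iIndepFun_pi (X := fun _ b => b) fun _ => aemeasurable_id
  exact (hcoord.indepFun_finset U V hUV measurable_pi_apply).comp
    (φ := F') (ψ := G') .of_discrete .of_discrete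

lemma variance_sum_le_of_mem_Icc {Ω α : Type*} [MeasurableSpace Ω] {μ : Measure Ω}
    [IsProbabilityMeasure μ] {X : α → Ω → ℝ} {s : Finset α} {m : ℝ}
    (hX : ∀ i ∈ s, AEMeasurable (X i) μ) (h01 : ∀ i ∈ s, ∀ ω, X i ω ∈ Set.Icc (0 : ℝ) 1)
    (hmean : ∀ i ∈ s, μ[X i] = m) (hindep : Set.Pairwise ↑s fun i j => X i ⟂ᵢ[μ] X j) :
    Var[∑ i ∈ s, X i; μ] ≤ s.card * ((1 - m) * m) := by
  rw [IndepFun.variance_sum (fun i hi => memLp_of_bounded (ae_of_all _ (h01 i hi))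
    (hX i hi).aestronglyMeasurable 2) hindep, ← nsmul_eq_mul]
  refine Finset.sum_le_card_nsmul _ _ _ fun i hi => ?_
  have h := variance_le_sub_mul_sub (ae_of_all μ (h01 i hi)) (hX i hi)
  rwa [hmean i hi, sub_zero] at h

variable {n : ℕ} {p : unitInterval}

lemma integral_edgeVector (e : BipEdge n) :
    ∫ A, edgeVector A e ∂bernoulliCube (BipEdge n) p = p := by
  refine (integral_comp_eval (μ := fun _ : BipEdge n => bernoulliMeasure true false p)
    (i := e) (f := fun b => if b = true then (1 : ℝ) else 0) .of_discrete).trans ?_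
  simp [integral_bernoulliMeasure]

lemma edgeVector_mem_Icc (A : BipEdge n → Bool) (e : BipEdge n) :
    edgeVector A e ∈ Set.Icc (0 : ℝ) 1 := by
  unfold edgeVector
  split_ifs <;> simp

lemma variance_sum_edgeVector_le (S : Finset (Fin n)) (j : Fin n) :
    Var[∑ i ∈ S, fun A => edgeVector A (i, j); bernoulliCube (BipEdge n) p] ≤
      S.card * ((1 - p) * p) := by
  refine variance_sum_le_of_mem_Icc (fun _ _ => .of_discrete)
    (fun _ _ A => edgeVector_mem_Icc A _) (fun _ _ => integral_edgeVector _) fun i _ k _ hik => ?_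
  refine indepFun_bernoulliCube_of_dependsOn (U := {(i, j)}) (V := {(k, j)}) (by simpa) ?_ ?_ <;>
    exact fun A B h => by
      simp only [edgeVector, h _ (Finset.mem_coe.2 (Finset.mem_singleton_self _))]

lemma integral_sq_one_sub_sum_edgeVector_le {d : ℝ} {S : Finset (Fin n)}
    (hS : S.card * (p : ℝ) ≤ d) (j : Fin n) :
    ∫ A, (1 - ∑ i ∈ S, edgeVector A (i, j)) ^ 2 ∂bernoulliCube (BipEdge n) p ≤
      1 + d + d ^ 2 := by
  have hSp : 0 ≤ S.card * (p : ℝ) := mul_nonneg (Nat.cast_nonneg _) p.2.1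
  have hmean : ∫ A, (1 - ∑ i ∈ S, edgeVector A (i, j)) ∂bernoulliCube (BipEdge n) p =
      1 - S.card * p := by
    rw [integral_sub .of_finite .of_finite, integral_finsetSum _ fun _ _ => .of_finite]
    simp [integral_edgeVector]
  have hvar : Var[fun A => 1 - ∑ i ∈ S, edgeVector A (i, j); bernoulliCube (BipEdge n) p] ≤
      S.card * ((1 - p) * p) := by
    rw [variance_const_sub .of_discrete]
    convert variance_sum_edgeVector_le S j using 2
    ext A
    rw [Finset.sum_apply]
  rw [variance_eq_sub .of_discrete, hmean, sub_le_iff_le_add] at hvar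
  refine hvar.trans ?_
  nlinarith [mul_nonneg hSp p.2.1, mul_self_le_mul_self hSp hS]

lemma integral_sum_sq_greedyPoly_le {d : ℝ} {S T : Finset (Fin n)}
    (hS : S.card * (p : ℝ) ≤ d) :
    ∫ A, ∑ v, (greedyPoly S T).value A v ^ 2 ∂bernoulliCube (BipEdge n) p ≤
      S.card + T.card * (1 + d + d ^ 2) := by
  have hsum (A : BipEdge n → Bool) : ∑ v, (greedyPoly S T).value A v ^ 2 =
      S.card + ∑ j ∈ T, (1 - ∑ i ∈ S, edgeVector A (i, j)) ^ 2 := by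
    rw [Fintype.sum_sum_type]
    simp only [greedyPoly_value_inl, greedyPoly_value_inr, ite_pow, one_pow, ne_eq,
      OfNat.ofNat_ne_zero, not_false_eq_true, zero_pow, Finset.sum_ite_mem, Finset.univ_inter,
      Finset.sum_const, nsmul_eq_mul, mul_one]
  simp only [hsum]
  rw [integral_add .of_finite .of_finite, integral_finsetSum _ fun _ _ => .of_finite,
    integral_const, probReal_univ, one_smul, ← nsmul_eq_mul]
  gcongr
  exact Finset.sum_le_card_nsmul _ _ _ fun j _ => integral_sq_one_sub_sum_edgeVector_le hS j

/-- The indicator of the event that `j` has no neighbours in `S`. -/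
noncomputable def freeIndicator (S : Finset (Fin n)) (j : Fin n) : (BipEdge n → Bool) → ℝ :=
  Set.indicator {A | ∀ i ∈ S, A (i, j) = false} 1

lemma card_freeVertices (S T : Finset (Fin n)) (A : BipEdge n → Bool) :
    ((freeVertices S T A).card : ℝ) = (∑ j ∈ T, freeIndicator S j) A := by
  rw [freeVertices, Finset.card_filter, Finset.sum_apply]
  push_cast
  exact Finset.sum_congr rfl fun j _ => by simp [freeIndicator, Set.indicator_apply]

lemma integral_freeIndicator (S : Finset (Fin n)) (j : Fin n) :
    ∫ A, freeIndicator S j A ∂bernoulliCube (BipEdge n) p = (1 - p) ^ S.card := by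
  have h := measureReal_bernoulliCube_forall_false (p := p) (S ×ˢ ({j} : Finset (Fin n)))
  rw [Finset.card_product, Finset.card_singleton, mul_one] at h
  rw [freeIndicator, integral_indicator_one .of_discrete, ← h]
  congr 1
  ext A
  simp

lemma variance_card_freeVertices_le (S T : Finset (Fin n)) :
    Var[fun A => ((freeVertices S T A).card : ℝ); bernoulliCube (BipEdge n) p] ≤
      T.card * (S.card * p) := by
  have hp : 0 ≤ 1 - (p : ℝ) := sub_nonneg.2 p.2.2
  have hbernoulli : 1 - S.card * (p : ℝ) ≤ (1 - p) ^ S.card := by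
    simpa [← sub_eq_add_neg] using
      one_add_mul_le_pow (a := -(p : ℝ)) (by linarith) S.card
  have hdep (j : Fin n) : DependsOn (freeIndicator S j) (S ×ˢ {j} : Finset (BipEdge n)) := by
    intro A B h
    have hiff : (∀ i ∈ S, A (i, j) = false) ↔ ∀ i ∈ S, B (i, j) = false :=
      forall₂_congr fun i hi => by rw [h (i, j) (by simpa using hi)]
    simp only [freeIndicator, Set.indicator_apply, Set.mem_ofPred_eq, hiff, Pi.one_apply]
  simp only [card_freeVertices]
  refine (variance_sum_le_of_mem_Icc (fun _ _ => .of_discrete) (fun j _ A => ?_)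
    (fun j _ => integral_freeIndicator S j) fun j _ k _ hjk => ?_).trans ?_
  · simp only [freeIndicator, Set.indicator_apply]
    split_ifs <;> simp
  · exact indepFun_bernoulliCube_of_dependsOn
      (Finset.disjoint_product.2 (.inr (by simpa))) (hdep j) (hdep k)
  · refine mul_le_mul_of_nonneg_left ?_ (Nat.cast_nonneg _)
    nlinarith [pow_nonneg hp S.card, pow_le_one₀ (n := S.card) hp (by linarith [p.2.1])]

lemma measureReal_card_freeVertices_lt_le {S T : Finset (Fin n)} {c k : ℝ} (hc : 0 < c)
    (hT : T.Nonempty) (hST : S.card ≤ T.card)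
    (hk : k + c * T.card ≤ T.card * (1 - p) ^ S.card) :
    (bernoulliCube (BipEdge n) p).real {A | ¬ k ≤ (freeVertices S T A).card} ≤ p / c ^ 2 := by
  have hT0 : (0 : ℝ) < T.card := Nat.cast_pos.2 hT.card_pos
  have hmean : ∫ A, ((freeVertices S T A).card : ℝ) ∂bernoulliCube (BipEdge n) p =
      T.card * (1 - p) ^ S.card := by
    simp only [card_freeVertices, Finset.sum_apply]
    rw [integral_finsetSum _ fun _ _ => .of_finite]
    simp [integral_freeIndicator]
  have hchebyshev := meas_ge_le_variance_div_sq (μ := bernoulliCube (BipEdge n) p)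
    (X := fun A => ((freeVertices S T A).card : ℝ)) .of_discrete (mul_pos hc hT0)
  rw [hmean] at hchebyshev
  calc (bernoulliCube (BipEdge n) p).real {A | ¬ k ≤ (freeVertices S T A).card}
      ≤ (bernoulliCube (BipEdge n) p).real {A | c * T.card ≤
          |((freeVertices S T A).card : ℝ) - T.card * (1 - p) ^ S.card|} :=
        measureReal_mono fun A hA => by
          have hlt : ((freeVertices S T A).card : ℝ) < k := not_le.1 hA
          rw [Set.mem_ofPred_eq, le_abs]
          exact .inr (by linarith)
    _ ≤ Var[fun A => ((freeVertices S T A).card : ℝ); bernoulliCube (BipEdge n) p] /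
          (c * T.card) ^ 2 :=
        ENNReal.toReal_le_of_le_ofReal (div_nonneg (variance_nonneg _ _) (sq_nonneg _)) hchebyshev
    _ ≤ T.card * (T.card * p) / (c * T.card) ^ 2 := by
        gcongr
        refine (variance_card_freeVertices_le S T).trans ?_
        gcongr
        exact p.2.1
    _ = p / c ^ 2 := by
        field_simp

end Moments

/-! ### Attaining the threshold -/

lemma detOptimizes_of_integral_le {n : ℕ} {d kl kr δ ξ η : ℝ} {F : BipPoly n}
    (hnorm : ∫ A, ∑ v, F.value A v ^ 2 ∂randomBip n d ≤ ξ * (kl + kr))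
    (hsize : 1 - δ ≤ (randomBip n d).real {A | kl ≤ leftCard (roundedSet η A (F.value A)) ∧
      kr ≤ rightCard (roundedSet η A (F.value A))}) :
    DetOptimizes n d kl kr δ ξ η F := by
  refine ⟨?_, ?_⟩
  · rw [Measure.prod_dirac, lintegral_map .of_discrete (by fun_prop),
      ← ofReal_integral_eq_lintegral_ofReal .of_finite
        (ae_of_all _ fun A => Finset.sum_nonneg fun v _ => sq_nonneg _)]
    exact ENNReal.ofReal_le_ofReal hnorm
  · rw [Measure.prod_dirac, Measure.map_apply (by fun_prop) (Set.toFinite _).measurableSet]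
    exact (ENNReal.ofReal_le_ofReal hsize).trans_eq ofReal_measureReal

lemma detOptimizes_zero {n : ℕ} {d kl kr ξ η : ℝ} (hξ : 0 ≤ ξ) (hk : 0 ≤ kl + kr) :
    DetOptimizes n d kl kr 1 ξ η (0 : BipPoly n) := by
  refine detOptimizes_of_integral_le ?_ ?_
  · simpa [BipPoly.value] using mul_nonneg hξ hk
  · rw [sub_self]
    exact measureReal_nonneg

lemma detOptimizes_greedyPoly {n : ℕ} {S T : Finset (Fin n)} {d kl kr ξ c : ℝ} (h0 : 0 ≤ d)
    (hn : d ≤ n) (hc : 0 < c) (hT : T.Nonempty) (hST : S.card ≤ T.card)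
    (hnorm : S.card + T.card * (1 + d + d ^ 2) ≤ ξ * (kl + kr)) (hl : kl ≤ S.card)
    (hr : kr + c * T.card ≤ T.card * (1 - d / n) ^ S.card) :
    DetOptimizes n d kl kr (d / n / c ^ 2) ξ 0 (greedyPoly S T) := by
  rw [← coe_edgeProb h0 hn] at hr ⊢
  have hSd : S.card * (edgeProb n d : ℝ) ≤ d := by
    have hcard : (S.card : ℝ) ≤ n := by exact_mod_cast card_finset_fin_le S
    rw [coe_edgeProb h0 hn, mul_div_left_comm]
    exact mul_le_of_le_one_right h0 (div_le_one_of_le₀ hcard (Nat.cast_nonneg n))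
  refine detOptimizes_of_integral_le ((integral_sum_sq_greedyPoly_le hSd).trans hnorm) ?_
  simp only [roundedSet_greedyPoly, leftCard_eq_card_toLeft, rightCard_eq_card_toRight,
    Finset.toLeft_disjSum, Finset.toRight_disjSum, hl, true_and]
  have hfew := measureReal_card_freeVertices_lt_le hc hT hST hr
  rw [← Set.compl_ofPred, probReal_compl_eq_one_sub .of_discrete] at hfew
  exact (sub_le_comm.1 hfew)

lemma exp_neg_mul_div_le_one_sub_pow {p : ℝ} (hp : p < 1) (s : ℕ) :
    Real.exp (-(s * p / (1 - p))) ≤ (1 - p) ^ s := by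
  have hp' : 0 < 1 - p := sub_pos.2 hp
  have hinv : (1 - p)⁻¹ ≤ Real.exp (p / (1 - p)) := by
    refine le_trans (le_of_eq ?_) (Real.add_one_le_exp _)
    field_simp
    ring
  rw [mul_div_assoc, ← mul_neg, Real.exp_nat_mul, Real.exp_neg]
  exact pow_le_pow_left₀ (inv_nonneg.2 (Real.exp_nonneg _)) (inv_le_of_inv_le₀ hp' hinv) s

open Filter Topology in
lemma eventually_le_one_sub_pow {ε d : ℝ} (hε : 0 < ε) (hd : 0 < d) :
    ∀ᶠ n : ℕ in atTop, ∀ s : ℕ, (s : ℝ) ≤ (1 - ε) * (Real.log d / d) * n + 1 →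
      (1 - ε / 2) * d ^ (ε - 1) ≤ (1 - d / n) ^ s := by
  have hdn : Tendsto (fun n : ℕ => d / (n : ℝ)) atTop (𝓝 0) :=
    tendsto_const_div_atTop_nhds_zero_nat d
  have hlim : Tendsto (fun n : ℕ => Real.exp (-(((1 - ε) * Real.log d + d / n) / (1 - d / n))))
      atTop (𝓝 (d ^ (ε - 1))) := by
    have h := (((hdn.const_add ((1 - ε) * Real.log d)).div (hdn.const_sub 1)
      (by norm_num)).neg).rexp
    have hval : -(((1 - ε) * Real.log d + 0) / (1 - 0)) = Real.log d * (ε - 1) := by ring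
    rwa [hval, ← Real.rpow_def_of_pos hd] at h
  have hlt : (1 - ε / 2) * d ^ (ε - 1) < d ^ (ε - 1) :=
    mul_lt_of_lt_one_left (Real.rpow_pos_of_pos hd _) (by linarith)
  filter_upwards [hlim.eventually_const_le hlt, hdn.eventually_lt_const one_pos,
    eventually_gt_atTop 0] with n hexp hp hn s hs
  have : (0 : ℝ) < n := Nat.cast_pos.2 hn
  have hsp : s * (d / n) ≤ (1 - ε) * Real.log d + d / n := by
    calc s * (d / n) ≤ ((1 - ε) * (Real.log d / d) * n + 1) * (d / n) := by gcongr
      _ = (1 - ε) * Real.log d + d / n := by field_simp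
  refine hexp.trans (le_trans ?_ (exp_neg_mul_div_le_one_sub_pow hp s))
  have := sub_pos.2 hp
  gcongr

/-- The pair `(kl, kr)` of set sizes is at least the factor `1 - ε` below the threshold. -/
structure SubcriticalSizes (ε d : ℝ) (n : ℕ) (kl kr : ℝ) : Prop where
  left_nonneg : 0 ≤ kl
  right_nonneg : 0 ≤ kr
  one_le_add : 1 ≤ kl + kr
  left_le : kl ≤ (1 - ε) * (Real.log d / d) * n
  right_le : kr ≤ (1 - ε) * d ^ (ε - 1) * n

namespace SubcriticalSizes

variable {ε d kl kr : ℝ} {n : ℕ}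

lemma natCast_pos (h : SubcriticalSizes ε d n kl kr) : (0 : ℝ) < n := by
  refine Nat.cast_pos.2 (Nat.pos_of_ne_zero ?_)
  rintro rfl
  have hl := h.left_le
  have hr := h.right_le
  rw [Nat.cast_zero, mul_zero] at hl hr
  linarith [h.one_le_add]

lemma lt_one (h : SubcriticalSizes ε d n kl kr) (hd : 0 < d) : ε < 1 := by
  by_contra! hε
  rcases hε.eq_or_lt with rfl | hε
  · have hl := h.left_le
    have hr := h.right_le
    rw [sub_self, zero_mul, zero_mul] at hl hr
    linarith [h.one_le_add]
  · have hneg : (1 - ε) * d ^ (ε - 1) * n < 0 :=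
      mul_neg_of_neg_of_pos (mul_neg_of_neg_of_pos (sub_neg.2 hε) (Real.rpow_pos_of_pos hd _))
        h.natCast_pos
    linarith [h.right_nonneg, h.right_le]

lemma one_le (h : SubcriticalSizes ε d n kl kr) (hd : 0 < d) : 1 ≤ d := by
  by_contra! hd1
  have hneg : (1 - ε) * (Real.log d / d) * n < 0 :=
    mul_neg_of_neg_of_pos (mul_neg_of_pos_of_neg (sub_pos.2 (h.lt_one hd))
      (div_neg_of_neg_of_pos (Real.log_neg hd hd1) hd)) h.natCast_pos
  linarith [h.left_nonneg, h.left_le]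

lemma left_le_natCast (h : SubcriticalSizes ε d n kl kr) (hε : 0 ≤ ε) (hd : 0 < d) :
    kl ≤ n := by
  have hlog : Real.log d / d ≤ 1 :=
    (div_le_one hd).2 ((Real.log_le_sub_one_of_pos hd).trans (sub_le_self d zero_le_one))
  have hcoeff : (1 - ε) * (Real.log d / d) ≤ 1 :=
    mul_le_one₀ (sub_le_self 1 hε) (div_nonneg (Real.log_nonneg (h.one_le hd)) hd.le) hlog
  exact h.left_le.trans (mul_le_of_le_one_left (Nat.cast_nonneg n) hcoeff)

end SubcriticalSizes

lemma exists_greedy_sizes {a ε kl kr : ℝ} {n : ℕ} (ha : 0 < a) (ha1 : a ≤ 1) (hε : 0 ≤ ε)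
    (hε1 : ε ≤ 1) (hn : 0 < n) (hkl : 0 ≤ kl) (hkr : 0 ≤ kr) (hk : 1 ≤ kl + kr) (hl : kl ≤ n)
    (hr : kr ≤ (1 - ε) * a * n) :
    ∃ s t : ℕ, 0 < t ∧ t ≤ n ∧ s ≤ t ∧ kl ≤ s ∧ s ≤ kl + 1 ∧ t ≤ (8 / a + 1) * (kl + kr) ∧
      kr ≤ (1 - 3 * ε / 4) * a * t := by
  have hsl : kl ≤ ⌈kl⌉₊ := Nat.le_ceil kl
  have hsu : (⌈kl⌉₊ : ℝ) ≤ kl + 1 := (Nat.ceil_lt_add_one hkl).le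
  obtain ⟨u, hu⟩ : ∃ u : ℝ, u = 4 / a * (⌈kl⌉₊ + kr) := ⟨_, rfl⟩
  have hau : a * u = 4 * (⌈kl⌉₊ + kr) := by
    rw [hu]
    field_simp
  have hu0 : 0 < u := by
    rw [hu]
    exact mul_pos (by positivity) (by linarith)
  have hceil : u ≤ ⌈u⌉₊ := Nat.le_ceil u
  refine ⟨⌈kl⌉₊, min n ⌈u⌉₊, lt_min hn (Nat.ceil_pos.2 hu0), min_le_left _ _,
    le_min (Nat.ceil_le.2 hl) ?_, hsl, hsu, ?_, ?_⟩
  · have : (⌈kl⌉₊ : ℝ) ≤ ⌈u⌉₊ := by nlinarith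
    exact_mod_cast this
  · calc ((min n ⌈u⌉₊ : ℕ) : ℝ) ≤ ⌈u⌉₊ := Nat.cast_le.2 (min_le_right _ _)
      _ ≤ 4 / a * (⌈kl⌉₊ + kr) + 1 := hu ▸ (Nat.ceil_lt_add_one hu0.le).le
      _ ≤ 4 / a * (2 * (kl + kr)) + (kl + kr) := by
          gcongr
          linarith
      _ = (8 / a + 1) * (kl + kr) := by ring
  · rcases le_total n ⌈u⌉₊ with h | h
    · rw [min_eq_left h]
      refine hr.trans ?_
      gcongr
      linarith
    · rw [min_eq_right h]
      have hat : 4 * kr ≤ a * ⌈u⌉₊ := by nlinarith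
      nlinarith [mul_nonneg ha.le (hu0.le.trans hceil)]

open Filter in
lemma exists_eventually_detOptimizes_greedyPoly {ε d : ℝ} (hε : 0 < ε) (hε1 : ε < 1)
    (hd : 1 ≤ d) :
    ∃ ξ c : ℝ, 1 ≤ ξ ∧ ∀ᶠ n : ℕ in atTop, d ≤ n → ∀ kl kr : ℝ,
      SubcriticalSizes ε d n kl kr →
        ∃ S T : Finset (Fin n), DetOptimizes n d kl kr (d / n / c ^ 2) ξ 0 (greedyPoly S T) := by
  have hd0 : 0 < d := one_pos.trans_le hd
  obtain ⟨a, ha⟩ : ∃ a : ℝ, a = d ^ (ε - 1) := ⟨_, rfl⟩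
  have ha0 : 0 < a := ha ▸ Real.rpow_pos_of_pos hd0 _
  have ha1 : a ≤ 1 := ha ▸ Real.rpow_le_one_of_one_le_of_nonpos hd (by linarith)
  refine ⟨2 + (8 / a + 1) * (1 + d + d ^ 2), ε * a / 4, ?_, ?_⟩
  · have : 0 ≤ (8 / a + 1) * (1 + d + d ^ 2) := by positivity
    linarith
  filter_upwards [eventually_le_one_sub_pow hε hd0] with n hpow hn kl kr hk
  obtain ⟨s, t, ht0, htn, hst, hls, hsl, htk, hkt⟩ := exists_greedy_sizes ha0 ha1 hε.le hε1.le
    (Nat.cast_pos.1 hk.natCast_pos) hk.left_nonneg hk.right_nonneg hk.one_le_add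
    (hk.left_le_natCast hε.le hd0) (ha ▸ hk.right_le)
  obtain ⟨T, -, rfl⟩ := Finset.exists_subset_card_eq (s := (Finset.univ : Finset (Fin n)))
    (htn.trans_eq (Finset.card_fin n).symm)
  obtain ⟨S, -, rfl⟩ := Finset.exists_subset_card_eq hst
  refine ⟨S, T, detOptimizes_greedyPoly hd0.le hn (by positivity) (Finset.card_pos.1 ht0) hst
    ?_ hls ?_⟩
  · calc (S.card : ℝ) + T.card * (1 + d + d ^ 2)
        ≤ 2 * (kl + kr) + (8 / a + 1) * (kl + kr) * (1 + d + d ^ 2) := by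
          gcongr
          linarith [hk.right_nonneg, hk.one_le_add]
      _ = (2 + (8 / a + 1) * (1 + d + d ^ 2)) * (kl + kr) := by ring
  · calc kr + ε * a / 4 * T.card ≤ (1 - 3 * ε / 4) * a * T.card + ε * a / 4 * T.card := by gcongr
      _ = T.card * ((1 - ε / 2) * a) := by ring
      _ ≤ T.card * (1 - d / n) ^ S.card := by
          gcongr
          exact ha ▸ hpow S.card (hsl.trans (by linarith [hk.left_le]))

open Filter Topology in
lemma exists_tendsto_zero_of_eventually {Q : ℕ → ℝ → Prop} {δ₀ : ℕ → ℝ}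
    (hlim : Tendsto δ₀ atTop (𝓝 0)) (hnonneg : ∀ n, 0 ≤ δ₀ n) (hone : ∀ n, Q n 1)
    (hQ : ∀ᶠ n in atTop, Q n (δ₀ n)) :
    ∃ δ : ℕ → ℝ, (∀ n, δ n ∈ Set.Icc (0 : ℝ) 1) ∧ Tendsto δ atTop (𝓝 0) ∧ ∀ n, Q n (δ n) := by
  classical
  refine ⟨fun n => if δ₀ n ≤ 1 ∧ Q n (δ₀ n) then δ₀ n else 1, fun n => ?_, ?_, fun n => ?_⟩
  · dsimp only
    split_ifs with h
    · exact ⟨hnonneg n, h.1⟩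
    · simp
  · refine hlim.congr' ?_
    filter_upwards [hlim.eventually_le_const one_pos, hQ] with n hle hn
    rw [if_pos ⟨hle, hn⟩]
  · dsimp only
    split_ifs with h
    exacts [h.2, hone n]

open Filter Topology in
lemma exists_forall_detOptimizes {ε d : ℝ} (hε : 0 < ε) (hd : 0 < d) :
    ∃ ξ : ℝ, 1 ≤ ξ ∧ ∃ δ : ℕ → ℝ, (∀ n, δ n ∈ Set.Icc (0 : ℝ) 1) ∧ Tendsto δ atTop (𝓝 0) ∧
      ∀ n : ℕ, d ≤ n → ∀ kl kr : ℝ, SubcriticalSizes ε d n kl kr →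
        ∃ F : BipPoly n, F.DegreeLE 1 ∧ DetOptimizes n d kl kr (δ n) ξ 0 F := by
  by_cases hcase : ε < 1 ∧ 1 ≤ d
  · obtain ⟨ξ, c, hξ, hev⟩ := exists_eventually_detOptimizes_greedyPoly hε hcase.1 hcase.2
    have hlim : Tendsto (fun n : ℕ => d / n / c ^ 2) atTop (𝓝 0) := by
      simpa using (tendsto_const_div_atTop_nhds_zero_nat d).div_const (c ^ 2)
    refine ⟨ξ, hξ, exists_tendsto_zero_of_eventually (Q := fun n δ => d ≤ n → ∀ kl kr : ℝ,
      SubcriticalSizes ε d n kl kr → ∃ F : BipPoly n, F.DegreeLE 1 ∧ DetOptimizes n d kl kr δ ξ 0 F)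
      hlim (fun n => by positivity) (fun n _ kl kr hk => ⟨0, fun v => by simp, ?_⟩) ?_⟩
    · exact detOptimizes_zero (by linarith) (by linarith [hk.one_le_add])
    · filter_upwards [hev] with n h hn kl kr hk
      obtain ⟨S, T, hST⟩ := h hn kl kr hk
      exact ⟨greedyPoly S T, greedyPoly_degreeLE, hST⟩
  · exact ⟨1, le_rfl, 0, fun _ => by simp, tendsto_const_nhds,
      fun n _ kl kr hk => absurd ⟨hk.lt_one hd, hk.one_le hd⟩ hcase⟩

theorem theorem1p6 (ε : ℝ) (hε : 0 < ε) :
    (∀ d : ℝ, 0 < d → ∃ ξ : ℝ, 1 ≤ ξ ∧ ∃ δ : ℕ → ℝ,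
      (∀ n, δ n ∈ Set.Icc (0 : ℝ) 1) ∧ Filter.Tendsto δ Filter.atTop (nhds 0) ∧
      ∀ n : ℕ, d ≤ n → ∀ kl kr : ℝ, 0 ≤ kl → 0 ≤ kr → 1 ≤ kl + kr →
        kl ≤ (1 - ε) * (Real.log d / d) * n →
        kr ≤ (1 - ε) * d ^ (ε - 1) * n →
        ∃ F : BipPoly n, F.DegreeLE 1 ∧ DetOptimizes n d kl kr (δ n) ξ 0 F) ∧
    (∃ d₀ : ℝ, 0 < d₀ ∧ ∀ d : ℝ, d₀ ≤ d →
      ∃ (n₀ : ℕ) (η C₁ C₂ : ℝ), 0 < n₀ ∧ 0 < η ∧ 0 < C₁ ∧ 0 < C₂ ∧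
      ∀ n : ℕ, n₀ ≤ n → ∀ kl kr : ℝ, (1 + ε) * (Real.log d / d) * n ≤ min kl kr →
      ∀ ξ : ℝ, 1 ≤ ξ → ∀ D : ℕ, 1 ≤ D → (D : ℝ) ≤ C₁ * n / (ξ * Real.log n) →
      ∀ δ : ℝ, 0 ≤ δ → δ ≤ Real.exp (-(C₂ * ξ * D * Real.log n)) →
      ∀ (Ω : Type*) [MeasurableSpace Ω] (P : MeasureTheory.Measure Ω)
        [MeasureTheory.IsProbabilityMeasure P] (f : Ω → BipPoly n),
        IsRandomPoly D f → ¬ Optimizes P n d kl kr δ ξ η f) := by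
  refine ⟨fun d hd => ?_, ?_⟩
  · obtain ⟨ξ, hξ, δ, hδ, hlim, hopt⟩ := exists_forall_detOptimizes hε hd
    exact ⟨ξ, hξ, δ, hδ, hlim, fun n hn kl kr hkl hkr hk hl hr =>
      hopt n hn kl kr ⟨hkl, hkr, hk, hl, hr⟩⟩
  · obtain ⟨d₀, hd₀, H⟩ := exists_forall_not_optimizes hε
    refine ⟨d₀, hd₀, fun d hd => ?_⟩
    obtain ⟨n₀, η, C₁, C₂, hn₀, hη, hC₁, hC₂, hnot⟩ := H d hd
    exact ⟨n₀, η, C₁, C₂, hn₀, hη, hC₁, hC₂, fun n hn kl kr hk ξ hξ D hD hDle δ _ =>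
      hnot n hn kl kr hk ξ hξ D hD hDle δ⟩
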